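/- Let $\mathcal{O}=\mathbb{C}\{x,y\}$ be the ring of convergent power series, with maximal ideal $\mathfrak{m}=\langle x,y\rangle$, and let $\widehat{\mathcal{O}}=\mathbb{C}[[x,y]]$ be the ring of formal power series, with maximal ideal $\widehat{\mathfrak{m}}=\langle x,y\rangle$. Write $\mathrm{Der}$ and $\widehat{\mathrm{Der}}$ for the modules of $\mathbb{C}$-derivations of $\mathcal{O}$ and of $\widehat{\mathcal{O}}$. A derivation is called singular if it lies in $\mathfrak{m}\,\mathrm{Der}$ (resp. $\widehat{\mathfrak{m}}\,\widehat{\mathrm{Der}}$), and logarithmic for $f$ if $\delta(f)\in\langle f\rangle$. The series $f\in\mathcal{O}$ is called a product if some $\delta\in\mathrm{Der}$ is logarithmic for $f$ but not singular. A derivation $\delta\in\widehat{\mathrm{Der}}$ is called topologically nilpotent if for every $g\in\widehat{\mathcal{O}}$ and every $k\in\mathbb{N}$ there is $N_0$ such that $\delta^N(g)\in\widehat{\mathfrak{m}}^k$ for all $N\ge N_0$; a derivation in $\mathrm{Der}$ is called topologically nilpotent if its unique extension to a derivation of $\widehat{\mathcal{O}}$ is. Let $f\in\mathcal{O}$ be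 reduced (that is, without repeated factors in $\mathcal{O}$; in particular $f\neq0$) and not a product, and suppose $f\in\mathfrak{m}^3$. Then: (1) every $\delta\in\mathrm{Der}$ that is singular and logarithmic for $f$ and satisfies $\delta(f)\in\mathfrak{m}f$ is topologically nilpotent; (2) likewise, every $\delta\in\widehat{\mathrm{Der}}$ that is singular and logarithmic for $f$ (in $\widehat{\mathcal{O}}$) and satisfies $\delta(f)\in\widehat{\mathfrak{m}}f$ is topologically nilpotent. -/

import Mathlib

namespace PlaneCurve

/-- The ring `ℂ[[x₁, …, xₙ]]` of formal power series. -/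
abbrev Formal (n : ℕ) : Type := MvPowerSeries (Fin n) ℂ

/-- The power series converges absolutely at `(r, …, r)`, hence on the closed polydisc of
radius `r` around the origin. -/
def ConvergesAt {n : ℕ} (f : Formal n) (r : ℝ) : Prop :=
  Summable fun a : Fin n →₀ ℕ => ‖MvPowerSeries.coeff a f‖ * r ^ a.degree

theorem ConvergesAt.mono {n : ℕ} {f : Formal n} {r s : ℝ} (h : ConvergesAt f r)
    (hs : 0 ≤ s) (hsr : s ≤ r) : ConvergesAt f s :=
  Summable.of_nonneg_of_le (fun _ => by positivity) (fun _ => by gcongr) h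

theorem ConvergesAt.add {n : ℕ} {f g : Formal n} {r : ℝ} (hr : 0 ≤ r) (hf : ConvergesAt f r)
    (hg : ConvergesAt g r) : ConvergesAt (f + g) r := by
  refine Summable.of_nonneg_of_le (fun _ => by positivity) (fun a => ?_) (Summable.add hf hg)
  rw [map_add, ← add_mul]
  gcongr
  exact norm_add_le _ _

theorem ConvergesAt.mul {n : ℕ} {f g : Formal n} {r : ℝ} (hr : 0 ≤ r) (hf : ConvergesAt f r)
    (hg : ConvergesAt g r) : ConvergesAt (f * g) r := by
  classical
  have h := summable_sum_mul_antidiagonal_of_summable_mul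
    (Summable.mul_of_nonneg hf hg (fun _ => by positivity) (fun _ => by positivity))
  refine Summable.of_nonneg_of_le (fun _ => by positivity) (fun a => ?_) h
  rw [MvPowerSeries.coeff_mul]
  refine (mul_le_mul_of_nonneg_right (norm_sum_le _ _) (by positivity)).trans ?_
  rw [Finset.sum_mul]
  refine Finset.sum_le_sum fun p hp => le_of_eq ?_
  rw [← Finset.HasAntidiagonal.mem_antidiagonal.1 hp, map_add, pow_add, norm_mul]
  ring

theorem convergesAt_of_finite {n : ℕ} {f : Formal n} (r : ℝ) (s : Finset (Fin n →₀ ℕ))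
    (h : ∀ a ∉ s, MvPowerSeries.coeff a f = 0) : ConvergesAt f r :=
  summable_of_ne_finset_zero (s := s) fun a ha => by simp [h a ha]

/-- The ring `ℂ{x₁, …, xₙ}` of convergent power series, inside `ℂ[[x₁, …, xₙ]]`: the series that
converge absolutely on some polydisc around the origin. -/
def convergent (n : ℕ) : Subalgebra ℂ (Formal n) where
  carrier := {f | ∃ r : ℝ, 0 < r ∧ ConvergesAt f r}
  mul_mem' := by
    rintro f g ⟨r, hr, hf⟩ ⟨s, hs, hg⟩
    exact ⟨min r s, lt_min hr hs, (hf.mono (le_min hr.le hs.le) (min_le_left _ _)).mul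
      (le_min hr.le hs.le) (hg.mono (le_min hr.le hs.le) (min_le_right _ _))⟩
  add_mem' := by
    rintro f g ⟨r, hr, hf⟩ ⟨s, hs, hg⟩
    exact ⟨min r s, lt_min hr hs, (hf.mono (le_min hr.le hs.le) (min_le_left _ _)).add
      (le_min hr.le hs.le) (hg.mono (le_min hr.le hs.le) (min_le_right _ _))⟩
  algebraMap_mem' c := by
    classical
    refine ⟨1, one_pos, convergesAt_of_finite 1 {0} fun a ha => ?_⟩
    rw [MvPowerSeries.algebraMap_apply, MvPowerSeries.coeff_C, if_neg (by simpa using ha)]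

theorem X_mem_convergent {n : ℕ} (i : Fin n) :
    (MvPowerSeries.X i : Formal n) ∈ convergent n := by
  classical
  refine ⟨1, one_pos, convergesAt_of_finite 1 {Finsupp.single i 1} fun a ha => ?_⟩
  rw [MvPowerSeries.coeff_X, if_neg (by simpa using ha)]

/-- The local ring `𝒪 = ℂ{x₁, …, xₙ}`. -/
abbrev Conv (n : ℕ) : Type := convergent n

/-- The coordinate `xᵢ` as a convergent power series. -/
noncomputable def convX {n : ℕ} (i : Fin n) : Conv n := ⟨MvPowerSeries.X i, X_mem_convergent i⟩

/-- The maximal ideal `𝔪 = ⟨x₁, …, xₙ⟩` of `ℂ{x₁, …, xₙ}`. -/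
noncomputable def maxConv (n : ℕ) : Ideal (Conv n) := Ideal.span (Set.range convX)

/-- The maximal ideal `⟨x₁, …, xₙ⟩` of `ℂ[[x₁, …, xₙ]]`. -/
noncomputable def maxFormal (n : ℕ) : Ideal (Formal n) := Ideal.span (Set.range MvPowerSeries.X)

/-- `Der_f`: the logarithmic derivations for `f`, i.e. the `ℂ`-derivations `δ` of the ring with
`δ(f) ∈ ⟨f⟩`. -/
def logDer {A : Type*} [CommRing A] [Algebra ℂ A] (f : A) : Submodule A (Derivation ℂ A A) where
  carrier := {δ | δ f ∈ Ideal.span {f}}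
  add_mem' h₁ h₂ := by
    simpa using Ideal.add_mem _ h₁ h₂
  zero_mem' := by simp
  smul_mem' a _ h := by
    simpa using Ideal.mul_mem_left _ a h

/-- The module `𝔪 Der` of singular derivations, for an ideal `𝔪` (the maximal ideal). -/
def singularDer {A : Type*} [CommRing A] [Algebra ℂ A] (m : Ideal A) :
    Submodule A (Derivation ℂ A A) :=
  m • (⊤ : Submodule A (Derivation ℂ A A))

/-- A convergent power series `f` is a product (at `0`) if it admits a non-singular logarithmic
derivation: `Der_f ⊄ 𝔪 Der`. -/
def IsProduct {n : ℕ} (f : Conv n) : Prop :=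
  ¬ logDer f ≤ singularDer (maxConv n)

/-- Topological nilpotency of a derivation of `ℂ[[x₁, …, xₙ]]`, for the filtration by the powers
of the maximal ideal: for every `g`, the sequence `δᴺ(g)` tends to `0`. -/
def IsTopNilpotent {n : ℕ} (δ : Derivation ℂ (Formal n) (Formal n)) : Prop :=
  ∀ (g : Formal n) (k : ℕ), ∃ N₀ : ℕ, ∀ N : ℕ, N₀ ≤ N → (⇑δ)^[N] g ∈ maxFormal n ^ k

/-- A derivation of `ℂ{x₁, …, xₙ}` is topologically nilpotent if its (unique) extension to a
derivation of `ℂ[[x₁, …, xₙ]]` is. -/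
def IsTopNilpotentConv {n : ℕ} (δ : Derivation ℂ (Conv n) (Conv n)) : Prop :=
  ∃ δ' : Derivation ℂ (Formal n) (Formal n),
    (∀ g : Conv n, δ' (g : Formal n) = ((δ g : Conv n) : Formal n)) ∧ IsTopNilpotent δ'

end PlaneCurve

/-!
Let `δ` be a singular derivation of `ℂ[[x, y]]` with `δ(f) = a f`, `a ∈ 𝔪`, and let `α`, `β` be the
eigenvalues of its action on `𝔪 / 𝔪²`. If both vanish, the iterated Leibniz rule shows that `δ` is
topologically nilpotent (`isTopNilpotent_of_sq`). Otherwise `f` has a multiple formal factor, which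
is seen as follows. The initial form of `f`, of degree `d ≥ 3`, is killed by the linear part of `δ`,
so there is a relation `p α + q β = 0` with `p + q = d` (`IsTriangular.exists_relation`); up to
exchanging the eigenvalues, `q ≥ 2` and `α ≠ 0`. Then `β / α ≤ 0`, so no resonance `n α = β` with
`n ≥ 2` occurs, and the eigenvector for `β` extends to a smooth invariant formal curve `h = 0`
(`IsTriangular.exists_separatrix`). On this curve, `δ` acts as `α t ∂/∂t` to first order, so an
eigenfunction that does not vanish identically on it has eigenvalue `i α`, where `i` is its order
of vanishing there. For `f` the eigenvalue is `0` and `i ≥ d`, for `f / h` it is `-β` and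
`i ≥ d - 1`; neither is possible, so `h²` divides `f` (`IsTriangular.exists_sq_dvd`).

It remains to see that a squarefree convergent series has no multiple formal factor
(`isUnit_of_sq_dvd`). Weierstrass division, proved for convergent series by a Neumann series in a
weighted `ℓ¹` norm (`exists_weierstrass_division`), reduces this, once the powers of `x` are split
off, to a Weierstrass polynomial `P ∈ ℂ{x}[Y]`. Gauss' lemma over the discrete valuation ring `ℂ{x}` makes `P` separable over
the fraction field, so `P` and `∂P/∂Y` generate an ideal that contains some `c ≠ 0` in `ℂ{x}`. A
multiple formal factor of `P` divides `c`, hence a power of `x`, but `x` does not divide `P`.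

Finally, a derivation of `ℂ{x, y}` extends to `ℂ[[x, y]]` as `δ(x) ∂/∂x + δ(y) ∂/∂y`
(`eq_pderiv_combination`), which reduces the convergent case to the formal one.
-/

namespace PlaneCurve

open MvPowerSeries Finsupp

/-! ### Dividing by powers of a variable, and the filtration by powers of the maximal ideal -/

/-- The quotient of the division of a power series by `xᵢ ^ d`: the monomials that are not
multiples of `xᵢ ^ d` are dropped, the others are divided by it. -/
noncomputable def shift {n : ℕ} (i : Fin n) (d : ℕ) : Formal n →ₗ[ℂ] Formal n where
  toFun f := fun a => coeff (a + single i d) f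
  map_add' _ _ := rfl
  map_smul' _ _ := rfl

theorem coeff_shift {n : ℕ} (i : Fin n) (d : ℕ) (f : Formal n) (a : Fin n →₀ ℕ) :
    coeff a (shift i d f) = coeff (a + single i d) f := rfl

theorem coeff_X_pow_mul {n : ℕ} (i : Fin n) (d : ℕ) (f : Formal n) (a : Fin n →₀ ℕ) :
    coeff a (X i ^ d * f) = if d ≤ a i then coeff (a - single i d) f else 0 := by
  rw [X_pow_eq, coeff_monomial_mul, one_mul]
  simp only [single_le_iff]

theorem coeff_X_pow_mul_shift {n : ℕ} (i : Fin n) (d : ℕ) (f : Formal n) (a : Fin n →₀ ℕ) :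
    coeff a (X i ^ d * shift i d f) = if d ≤ a i then coeff a f else 0 := by
  rw [coeff_X_pow_mul]
  split_ifs with h
  · rw [coeff_shift, tsub_add_cancel_of_le (single_le_iff.2 h)]
  · rfl

theorem shift_X_pow_mul {n : ℕ} (i : Fin n) (d : ℕ) (f : Formal n) :
    shift i d (X i ^ d * f) = f := by
  ext a
  rw [coeff_shift, coeff_X_pow_mul, if_pos (by simp), add_tsub_cancel_right]

/-- The series obtained by setting `xᵢ = 0`. -/
noncomputable def setZero {n : ℕ} (i : Fin n) (f : Formal n) : Formal n := f - X i * shift i 1 f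

theorem coeff_setZero {n : ℕ} (i : Fin n) (f : Formal n) (a : Fin n →₀ ℕ) :
    coeff a (setZero i f) = if a i = 0 then coeff a f else 0 := by
  have h := coeff_X_pow_mul_shift i 1 f a
  rw [pow_one] at h
  rw [setZero, map_sub, h]
  rcases Nat.eq_zero_or_pos (a i) with h | h
  · simp [h]
  · simp [h.ne', Nat.succ_le_of_lt h]

theorem eq_C_add_X_mul (g : Formal 2) :
    g = C (constantCoeff g) + X 0 * shift 0 1 g + X 1 * shift 1 1 (setZero 0 g) := by
  have h1 : g = setZero 0 g + X 0 * shift 0 1 g := by simp [setZero]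
  have h2 : setZero 0 g = setZero 1 (setZero 0 g) + X 1 * shift 1 1 (setZero 0 g) := by
    simp [setZero]
  have h3 : setZero 1 (setZero 0 g) = C (constantCoeff g) := by
    ext a
    rw [coeff_setZero, coeff_setZero, coeff_C]
    by_cases h : a = 0
    · simp [h]
    · rw [if_neg h]
      split_ifs with h1 h0
      · exact absurd (Finsupp.ext fun i => by fin_cases i <;> simp [h0, h1]) h
      · rfl
      · rfl
  rw [h3] at h2
  rw [h2] at h1
  linear_combination h1

theorem X_mem_maxFormal {n : ℕ} (i : Fin n) : (X i : Formal n) ∈ maxFormal n :=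
  Ideal.subset_span ⟨i, rfl⟩

theorem mem_maxFormal_pow_iff {k : ℕ} {g : Formal 2} :
    g ∈ maxFormal 2 ^ k ↔ (k : ℕ∞) ≤ g.order := by
  constructor
  · have hX : ∀ a ∈ maxFormal 2, (1 : ℕ∞) ≤ a.order := by
      intro a ha
      rw [one_le_order_iff_constCoeff_eq_zero]
      have : maxFormal 2 ≤ RingHom.ker (constantCoeff (σ := Fin 2) (R := ℂ)) := by
        rw [maxFormal, Ideal.span_le]
        rintro _ ⟨i, rfl⟩
        simp [RingHom.mem_ker]
      exact this ha
    induction k generalizing g with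
    | zero => simp
    | succ k ih =>
      intro h
      rw [pow_succ] at h
      refine Submodule.mul_induction_on h (fun a ha b hb => ?_) (fun a b ha hb => ?_)
      · rw [order_mul]
        push_cast
        exact add_le_add (ih ha) (hX b hb)
      · exact (le_min ha hb).trans min_order_le_add
  · induction k generalizing g with
    | zero => simp
    | succ k ih =>
      intro h
      have hc : ∀ a : Fin 2 →₀ ℕ, a.degree < k + 1 → coeff a g = 0 := fun a ha =>
        coeff_of_lt_order (lt_of_lt_of_le (by exact_mod_cast ha) h)
      rw [eq_C_add_X_mul g, show constantCoeff g = 0 from hc 0 (by simp), map_zero, zero_add,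
        pow_succ']
      refine add_mem (Ideal.mul_mem_mul (X_mem_maxFormal 0) (ih ?_))
        (Ideal.mul_mem_mul (X_mem_maxFormal 1) (ih ?_))
      · refine nat_le_order fun a ha => ?_
        rw [coeff_shift]
        exact hc _ (by simpa using ha)
      · refine nat_le_order fun a ha => ?_
        rw [coeff_shift, coeff_setZero]
        split_ifs
        · exact hc _ (by simpa using ha)
        · rfl

theorem mem_maxFormal_iff {g : Formal 2} : g ∈ maxFormal 2 ↔ constantCoeff g = 0 := by
  rw [← pow_one (maxFormal 2), mem_maxFormal_pow_iff, Nat.cast_one,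
    one_le_order_iff_constCoeff_eq_zero]

theorem sub_C_mem_maxFormal (g : Formal 2) : g - C (constantCoeff g) ∈ maxFormal 2 := by
  simp [mem_maxFormal_iff]

theorem not_isUnit_of_mem_maxFormal {g : Formal 2} (h : g ∈ maxFormal 2) : ¬ IsUnit g := by
  rw [isUnit_iff_constantCoeff, mem_maxFormal_iff.1 h]
  simp

theorem eq_zero_of_forall_mem_pow {g : Formal 2} (h : ∀ k, g ∈ maxFormal 2 ^ k) : g = 0 := by
  rw [← order_eq_top_iff, ENat.eq_top_iff_forall_ge]
  exact fun k => mem_maxFormal_pow_iff.1 (h k)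

/-- A sequence of formal power series whose successive differences tend to `0` converges, with an
explicit rate. -/
theorem exists_limit_of_sub_mem (s : ℕ → Formal 2) (N : ℕ)
    (hs : ∀ n, N ≤ n → s (n + 1) - s n ∈ maxFormal 2 ^ n) :
    ∃ t : Formal 2, ∀ n, N ≤ n → t - s n ∈ maxFormal 2 ^ n := by
  have hdiff : ∀ n, N ≤ n → ∀ k, s (n + k) - s n ∈ maxFormal 2 ^ n := by
    intro n hn k
    induction k with
    | zero => simp
    | succ k ih =>
      have := Ideal.pow_le_pow_right (Nat.le_add_right n k) (hs (n + k) (by omega))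
      simpa [add_assoc] using add_mem this ih
  obtain ⟨t, ht⟩ : ∃ t : Formal 2, ∀ a, coeff a t = coeff a (s (N + a.degree + 1)) :=
    ⟨fun a => coeff a (s (N + a.degree + 1)), fun _ => rfl⟩
  refine ⟨t, fun n hn => ?_⟩
  rw [mem_maxFormal_pow_iff]
  refine nat_le_order fun a ha => ?_
  rw [map_sub, sub_eq_zero, ht]
  have key : ∀ p q, N ≤ p → p ≤ q → a.degree < p → coeff a (s q) = coeff a (s p) := by
    intro p q hp hpq hap
    obtain ⟨k, rfl⟩ := Nat.exists_eq_add_of_le hpq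
    have := coeff_of_lt_order (lt_of_lt_of_le (by exact_mod_cast hap)
      (mem_maxFormal_pow_iff.1 (hdiff p hp k)))
    rwa [map_sub, sub_eq_zero] at this
  rcases le_total n (N + a.degree + 1) with h | h
  · exact key _ _ hn h ha
  · exact (key _ _ (by omega) h (by omega)).symm

/-- Principal ideals of the formal power series ring are closed (Krull's intersection theorem). -/
theorem dvd_of_forall_mem_sup {g h : Formal 2}
    (hg : ∀ k, g ∈ Ideal.span {h} ⊔ maxFormal 2 ^ k) :
    h ∣ g := by
  rw [← Ideal.mem_span_singleton]
  have hle : maxFormal 2 ≤ Ideal.jacobson ⊥ := by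
    rw [IsLocalRing.jacobson_eq_maximalIdeal _ bot_ne_top]
    exact fun a ha => not_isUnit_of_mem_maxFormal ha
  have := IsHausdorff.of_le_jacobson (maxFormal 2) (Formal 2 ⧸ Ideal.span {h}) hle
  rw [← Ideal.Quotient.eq_zero_iff_mem]
  refine this.haus _ fun n => ?_
  rw [SModEq.zero]
  obtain ⟨a, ha, b, hb, rfl⟩ := Submodule.mem_sup.1 (hg n)
  rw [map_add, Ideal.Quotient.eq_zero_iff_mem.2 ha, zero_add]
  have hb' := Submodule.smul_mem_smul hb
    (Submodule.mem_top (R := Formal 2) (x := (1 : Formal 2 ⧸ Ideal.span {h})))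
  have hb1 : b • (1 : Formal 2 ⧸ Ideal.span {h}) = Ideal.Quotient.mk _ b := by
    change Ideal.Quotient.mk _ (b * 1) = _
    rw [mul_one]
  rwa [hb1] at hb'

/-! ### Singular derivations and topological nilpotency -/

theorem apply_mem_of_mem_singularDer {A : Type*} [CommRing A] [Algebra ℂ A] {m : Ideal A}
    {δ : Derivation ℂ A A} (h : δ ∈ singularDer m) (g : A) : δ g ∈ m := by
  refine Submodule.smul_induction_on h (fun r hr d _ => ?_) (fun d₁ d₂ h₁ h₂ => ?_)
  · exact m.mul_mem_right _ hr
  · exact m.add_mem h₁ h₂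

theorem apply_mem_pow {A : Type*} [CommRing A] [Algebra ℂ A] {m : Ideal A}
    {δ : Derivation ℂ A A} (hδ : ∀ g, δ g ∈ m) {k : ℕ} {g : A} (hg : g ∈ m ^ k) :
    δ g ∈ m ^ k := by
  induction k generalizing g with
  | zero => simp
  | succ k ih =>
    rw [pow_succ] at hg ⊢
    refine Submodule.mul_induction_on hg (fun a ha b hb => ?_) (fun a b ha hb => ?_)
    · rw [Derivation.leibniz, smul_eq_mul, smul_eq_mul, mul_comm b]
      exact add_mem (Ideal.mul_mem_mul ha (hδ b)) (Ideal.mul_mem_mul (ih ha) hb)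
    · rw [map_add]
      exact add_mem ha hb

theorem iterate_apply_mem_pow {A : Type*} [CommRing A] [Algebra ℂ A] {m : Ideal A}
    {δ : Derivation ℂ A A} (hδ : ∀ g, δ g ∈ m) {k : ℕ} (n : ℕ) {g : A} (hg : g ∈ m ^ k) :
    (⇑δ)^[n] g ∈ m ^ k := by
  induction n with
  | zero => simpa
  | succ n ih =>
    rw [Function.iterate_succ_apply']
    exact apply_mem_pow hδ ih

/-- A form of the iterated Leibniz rule that avoids the binomial coefficients. -/
theorem iterate_mul_mem {A : Type*} [CommRing A] [Algebra ℂ A] (δ : Derivation ℂ A A)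
    (I : Ideal A) (n : ℕ) : ∀ a b : A,
    (∀ i j, i + j = n → (⇑δ)^[i] a * (⇑δ)^[j] b ∈ I) → (⇑δ)^[n] (a * b) ∈ I := by
  induction n with
  | zero => exact fun a b h => h 0 0 rfl
  | succ n ih =>
    intro a b h
    rw [Function.iterate_succ_apply, Derivation.leibniz, smul_eq_mul, smul_eq_mul,
      iterate_map_add, mul_comm b]
    refine add_mem (ih _ _ fun i j hij => ?_) (ih _ _ fun i j hij => ?_)
    · have := h i (j + 1) (by omega)
      rwa [Function.iterate_succ_apply] at this
    · have := h (i + 1) j (by omega)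
      rwa [Function.iterate_succ_apply] at this

/-- If the square of `δ` vanishes on the cotangent space, then `δ` is topologically nilpotent. -/
theorem isTopNilpotent_of_sq {n : ℕ} {δ : Derivation ℂ (Formal n) (Formal n)}
    (hδ : ∀ g, δ g ∈ maxFormal n) (h2 : ∀ g ∈ maxFormal n, δ (δ g) ∈ maxFormal n ^ 2) :
    IsTopNilpotent δ := by
  have key : ∀ j, ∃ N, ∀ k, N ≤ k → ∀ g ∈ maxFormal n ^ j, (⇑δ)^[k] g ∈ maxFormal n ^ (j + 1) := by
    intro j
    induction j with
    | zero =>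
      refine ⟨1, fun k hk g _ => ?_⟩
      obtain ⟨k, rfl⟩ := Nat.exists_eq_add_of_le' hk
      rw [Function.iterate_succ_apply', zero_add, pow_one]
      exact hδ _
    | succ j ih =>
      obtain ⟨N, hN⟩ := ih
      refine ⟨N + 2, fun k hk g hg => ?_⟩
      rw [pow_succ] at hg
      refine Submodule.mul_induction_on hg (fun a ha b hb => ?_) (fun a b ha hb => ?_)
      · refine iterate_mul_mem δ _ k a b fun i l hil => ?_
        by_cases hl : 2 ≤ l
        · obtain ⟨l, rfl⟩ := Nat.exists_eq_add_of_le' hl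
          have : (⇑δ)^[l + 2] b ∈ maxFormal n ^ 2 := by
            rw [Function.iterate_add_apply]
            exact iterate_apply_mem_pow hδ l (h2 b hb)
          have := Ideal.mul_mem_mul (iterate_apply_mem_pow hδ i ha) this
          rwa [← pow_add] at this
        · have hb' : (⇑δ)^[l] b ∈ maxFormal n ^ 1 :=
            iterate_apply_mem_pow hδ l (by rwa [pow_one])
          have := Ideal.mul_mem_mul (hN i (by omega) a ha) hb'
          rwa [← pow_add] at this
      · rw [iterate_map_add]
        exact add_mem ha hb
  intro g k
  induction k with
  | zero => exact ⟨0, fun N _ => by simp⟩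
  | succ k ih =>
    obtain ⟨N₀, h0⟩ := ih
    obtain ⟨N₁, h1⟩ := key k
    refine ⟨N₁ + N₀, fun N hN => ?_⟩
    obtain ⟨l, rfl⟩ := Nat.exists_eq_add_of_le hN
    rw [show N₁ + N₀ + l = N₁ + (N₀ + l) by ring, Function.iterate_add_apply]
    exact h1 N₁ le_rfl _ (h0 _ (by omega))

/-! ### The linear part in triangular form -/

/-- Generators `u`, `v` of the maximal ideal of `ℂ[[x, y]]` for which the action of `δ` on the
cotangent space is triangular, with eigenvalues `α` and `β`:
`δ(u) ≡ α u + ε v` and `δ(v) ≡ β v` modulo `𝔪²`. -/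
structure IsTriangular (δ : Derivation ℂ (Formal 2) (Formal 2)) (u v : Formal 2)
    (α β ε : ℂ) : Prop where
  mem_span : ∀ g ∈ maxFormal 2, ∃ a b, g = a * u + b * v
  u_mem : u ∈ maxFormal 2
  v_mem : v ∈ maxFormal 2
  map_u : δ u - (C α * u + C ε * v) ∈ maxFormal 2 ^ 2
  map_v : δ v - C β * v ∈ maxFormal 2 ^ 2
  v_notMem : v ∉ maxFormal 2 ^ 2

theorem exists_linear_part {g : Formal 2} (hg : g ∈ maxFormal 2) :
    ∃ a b : ℂ, g - (C a * X 0 + C b * X 1) ∈ maxFormal 2 ^ 2 := by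
  refine ⟨constantCoeff (shift 0 1 g), constantCoeff (shift 1 1 (setZero 0 g)), ?_⟩
  have h := eq_C_add_X_mul g
  rw [mem_maxFormal_iff.1 hg, map_zero, zero_add] at h
  have h0 := Ideal.mul_mem_mul (X_mem_maxFormal 0) (sub_C_mem_maxFormal (shift 0 1 g))
  have h1 := Ideal.mul_mem_mul (X_mem_maxFormal 1)
    (sub_C_mem_maxFormal (shift 1 1 (setZero 0 g)))
  rw [← sq] at h0 h1
  convert add_mem h0 h1 using 1
  linear_combination h

theorem C_mul_X_add_notMem {a b : ℂ} (h : a ≠ 0 ∨ b ≠ 0) :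
    C a * X 0 + C b * X 1 ∉ maxFormal 2 ^ 2 := by
  intro hmem
  have key : ∀ i : Fin 2, coeff (single i 1) (C a * X 0 + C b * X 1 : Formal 2) = 0 := fun i =>
    coeff_of_lt_order (lt_of_lt_of_le (by simp) (mem_maxFormal_pow_iff.1 hmem))
  have h0 := key 0
  have h1 := key 1
  rw [map_add, coeff_C_mul, coeff_C_mul, coeff_index_single_X, coeff_index_single_X] at h0 h1
  simp at h0 h1
  tauto

theorem derivation_C_mul (δ : Derivation ℂ (Formal 2) (Formal 2)) (a : ℂ) (g : Formal 2) :
    δ (C a * g) = C a * δ g := by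
  rw [← smul_eq_C_mul, δ.map_smul, smul_eq_C_mul]

/-- Each root `μ` of the characteristic polynomial of the linear part can be placed as the second
eigenvalue of a triangular form; the first one is then the other root. -/
theorem exists_isTriangular {δ : Derivation ℂ (Formal 2) (Formal 2)} {a b c e μ : ℂ}
    (hx : δ (X 0) - (C a * X 0 + C b * X 1) ∈ maxFormal 2 ^ 2)
    (hy : δ (X 1) - (C c * X 0 + C e * X 1) ∈ maxFormal 2 ^ 2)
    (hμ : (a - μ) * (e - μ) = b * c) : ∃ u v ε, IsTriangular δ u v (a + e - μ) μ ε := by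
  -- the coordinates of an eigenvector
  obtain ⟨α, β, hne, h0, h1⟩ : ∃ α β : ℂ, (α ≠ 0 ∨ β ≠ 0) ∧ α * a + β * c = μ * α ∧
      α * b + β * e = μ * β := by
    by_cases h : c ≠ 0 ∨ μ - a ≠ 0
    · exact ⟨c, μ - a, h, by ring, by linear_combination -hμ⟩
    · push Not at h
      by_cases h' : e - μ ≠ 0 ∨ b ≠ 0
      · exact ⟨e - μ, -b, by simpa using h', by rw [h.1]; linear_combination (μ - e) * h.2,
          by ring⟩
      · push Not at h'
        exact ⟨1, 0, by simp, by linear_combination -h.2, by linear_combination h'.2⟩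
  have hspan : ∀ g ∈ maxFormal 2, ∃ r s, g = r * X 0 + s * X 1 := by
    intro g hg
    have h := eq_C_add_X_mul g
    rw [mem_maxFormal_iff.1 hg, map_zero, zero_add] at h
    exact ⟨shift 0 1 g, shift 1 1 (setZero 0 g), by linear_combination h⟩
  have hv : C α * X 0 + C β * X 1 ∈ maxFormal 2 :=
    add_mem (Ideal.mul_mem_left _ _ (X_mem_maxFormal 0))
      (Ideal.mul_mem_left _ _ (X_mem_maxFormal 1))
  have hδv : δ (C α * X 0 + C β * X 1) - C μ * (C α * X 0 + C β * X 1) ∈ maxFormal 2 ^ 2 := by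
    rw [map_add, derivation_C_mul, derivation_C_mul]
    have h0' := congrArg (C (σ := Fin 2)) h0
    have h1' := congrArg (C (σ := Fin 2)) h1
    simp only [map_add, map_mul] at h0' h1'
    convert add_mem (Ideal.mul_mem_left _ (C α) hx) (Ideal.mul_mem_left _ (C β) hy) using 1
    linear_combination X 0 * h0' + X 1 * h1'
  by_cases hα : α = 0
  · have hβ : β ≠ 0 := by tauto
    have heμ : e = μ := by
      rw [hα] at h1
      exact mul_left_cancel₀ hβ (by linear_combination h1)
    have hββ : C (σ := Fin 2) β * C β⁻¹ = 1 := by rw [← map_mul, mul_inv_cancel₀ hβ, map_one]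
    refine ⟨X 0, _, b / β, ?_, X_mem_maxFormal 0, hv, ?_, hδv, C_mul_X_add_notMem hne⟩
    · intro g hg
      obtain ⟨r, s, rfl⟩ := hspan g hg
      refine ⟨r, s * C β⁻¹, ?_⟩
      rw [hα, map_zero]
      linear_combination (-s * X 1) * hββ
    · convert hx using 1
      rw [hα, heμ, add_sub_cancel_right, map_zero, div_eq_mul_inv, map_mul]
      linear_combination (-C b * X 1) * hββ
  · have hαα : C (σ := Fin 2) α * C α⁻¹ = 1 := by rw [← map_mul, mul_inv_cancel₀ hα, map_one]
    refine ⟨X 1, _, c / α, ?_, X_mem_maxFormal 1, hv, ?_, hδv, C_mul_X_add_notMem hne⟩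
    · intro g hg
      obtain ⟨r, s, rfl⟩ := hspan g hg
      refine ⟨s - r * C α⁻¹ * C β, r * C α⁻¹, ?_⟩
      linear_combination (-r * X 0) * hαα
    · convert hy using 1
      have h2 : a + e - μ + c / α * β = e := by
        field_simp
        linear_combination h0
      have h2' := congrArg (C (σ := Fin 2)) h2
      rw [map_add, map_mul] at h2'
      have h3 : C (σ := Fin 2) (c / α) * C α = C c := by
        rw [← map_mul, div_mul_cancel₀ _ hα]
      linear_combination (-X 1) * h2' - X 0 * h3

theorem mul_mem_pow_of_le {A : Type*} [CommRing A] {m : Ideal A} {p q n : ℕ} {a b : A}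
    (ha : a ∈ m ^ p) (hb : b ∈ m ^ q) (h : n ≤ p + q) : a * b ∈ m ^ n := by
  refine Ideal.pow_le_pow_right h ?_
  rw [pow_add]
  exact Ideal.mul_mem_mul ha hb

namespace IsTriangular

variable {δ : Derivation ℂ (Formal 2) (Formal 2)} {u v : Formal 2} {α β ε : ℂ}

theorem exists_eq_of_mem_pow (T : IsTriangular δ u v α β ε) {i : ℕ} {r : Formal 2}
    (hr : r ∈ maxFormal 2 ^ i) :
    ∃ ρ s, s ∈ maxFormal 2 ^ (i - 1) ∧ r = ρ * u ^ i + v * s := by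
  induction i generalizing r with
  | zero => exact ⟨r, 0, zero_mem _, by simp⟩
  | succ i ih =>
    rw [pow_succ] at hr
    refine Submodule.mul_induction_on hr (fun a ha b hb => ?_) ?_
    · obtain ⟨c, e, rfl⟩ := T.mem_span b hb
      obtain ⟨ρ, s, hs, rfl⟩ := ih ha
      refine ⟨ρ * c, (ρ * u ^ i + v * s) * e + s * c * u, add_mem ?_ ?_, by ring⟩
      · exact Ideal.mul_mem_right _ _ ha
      · refine mul_mem_pow_of_le (Ideal.mul_mem_right _ _ hs) (q := 1) ?_ (by omega)
        simpa using T.u_mem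
    · rintro _ _ ⟨ρ, s, hs, rfl⟩ ⟨ρ', s', hs', rfl⟩
      exact ⟨ρ + ρ', s + s', add_mem hs hs', by ring⟩

theorem map_u_pow (T : IsTriangular δ u v α β ε) (i : ℕ) :
    ∃ t e, t ∈ maxFormal 2 ^ (i - 1) ∧ e ∈ maxFormal 2 ^ (i + 1) ∧
      δ (u ^ i) = C (i * α) * u ^ i + v * t + e := by
  induction i with
  | zero => exact ⟨0, 0, zero_mem _, zero_mem _, by simp⟩
  | succ i ih =>
    obtain ⟨t, e, ht, he, h⟩ := ih
    have hu : u ^ i ∈ maxFormal 2 ^ i := Ideal.pow_mem_pow T.u_mem i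
    have hu1 : u ∈ maxFormal 2 ^ 1 := by simpa using T.u_mem
    refine ⟨u * t + C ε * u ^ i, u * e + u ^ i * (δ u - (C α * u + C ε * v)), add_mem ?_ ?_,
      add_mem ?_ ?_, ?_⟩
    · exact mul_mem_pow_of_le hu1 ht (by omega)
    · exact Ideal.mul_mem_left _ _ hu
    · exact mul_mem_pow_of_le hu1 he (by omega)
    · exact mul_mem_pow_of_le hu T.map_u (by omega)
    · rw [pow_succ, Derivation.leibniz, h, smul_eq_mul, smul_eq_mul]
      have : C (σ := Fin 2) ((i + 1 : ℕ) * α) = C (i * α) + C α := by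
        rw [← map_add]
        push_cast
        ring_nf
      rw [this]
      ring

theorem map_v_pow (T : IsTriangular δ u v α β ε) (j : ℕ) :
    δ (v ^ j) - C (j * β) * v ^ j ∈ maxFormal 2 ^ (j + 1) := by
  induction j with
  | zero => simp
  | succ j ih =>
    have h1 := mul_mem_pow_of_le (n := j + 2) (q := 1) ih (by simpa using T.v_mem) (by omega)
    have h2 := mul_mem_pow_of_le (n := j + 2) (Ideal.pow_mem_pow T.v_mem j) T.map_v (by omega)
    have : C (σ := Fin 2) ((j + 1 : ℕ) * β) = C (j * β) + C β := by
      rw [← map_add]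
      push_cast
      ring_nf
    convert add_mem h1 h2 using 1
    rw [pow_succ, Derivation.leibniz, smul_eq_mul, smul_eq_mul, this]
    ring

/-- If `f` has order `d` and `δ` kills its initial form, then some monomial of degree `d` in the
eigenvectors has eigenvalue `0`. The initial form is filtered by the powers of `v` dividing it. -/
theorem exists_relation (T : IsTriangular δ u v α β ε) (hδ : ∀ g, δ g ∈ maxFormal 2) {d : ℕ}
    {f : Formal 2} (hf : f ∈ maxFormal 2 ^ d) (hf' : f ∉ maxFormal 2 ^ (d + 1))
    (hδf : δ f ∈ maxFormal 2 ^ (d + 1)) :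
    ∃ i j : ℕ, i + j = d ∧ (i : ℂ) * α + j * β = 0 := by
  by_contra! hcon
  have key : ∀ j, j ≤ d + 1 → ∃ g e, g ∈ maxFormal 2 ^ (d - j) ∧ e ∈ maxFormal 2 ^ (d + 1) ∧
      f = v ^ j * g + e := by
    intro j
    induction j with
    | zero => exact fun _ => ⟨f, 0, hf, zero_mem _, by simp⟩
    | succ j ih =>
      intro hj
      obtain ⟨g, e, hg, he, h⟩ := ih (by omega)
      obtain ⟨i, rfl⟩ := Nat.exists_eq_add_of_le' (show j ≤ d by omega)
      rw [Nat.add_sub_cancel] at hg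
      obtain ⟨ρ, s, hs, rfl⟩ := T.exists_eq_of_mem_pow hg
      obtain ⟨t, e₁, ht, he₁, hu⟩ := T.map_u_pow i
      have hκ := hcon i j rfl
      set κ : ℂ := i * α + j * β with hκdef
      have hκκ : C (σ := Fin 2) κ⁻¹ * C κ = 1 := by rw [← map_mul, inv_mul_cancel₀ hκ, map_one]
      have hκ' : C (σ := Fin 2) κ = C (i * α) + C (j * β) := by rw [← map_add]
      have hvj := Ideal.pow_mem_pow T.v_mem j
      have hui := Ideal.pow_mem_pow T.u_mem i
      set w := δ (v ^ j) - C (j * β) * v ^ j with hw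
      set w' := δ (v ^ (j + 1)) - C ((j + 1 : ℕ) * β) * v ^ (j + 1) with hw'
      have hwm : w ∈ maxFormal 2 ^ (j + 1) := T.map_v_pow j
      have hwm' : w' ∈ maxFormal 2 ^ (j + 1 + 1) := T.map_v_pow (j + 1)
      set s₁ := ρ * t + δ s + C ((j + 1 : ℕ) * β) * s with hs₁
      have hs₁m : s₁ ∈ maxFormal 2 ^ (i - 1) :=
        add_mem (add_mem (Ideal.mul_mem_left _ _ ht) (apply_mem_pow hδ hs))
          (Ideal.mul_mem_left _ _ hs)
      -- the class of `δ f` modulo `𝔪 ^ (d + 1)`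
      have hδf' : C κ * (ρ * u ^ i * v ^ j) + v ^ (j + 1) * s₁ ∈ maxFormal 2 ^ (i + j + 1) := by
        have e0 : δ ρ * (u ^ i * v ^ j) ∈ maxFormal 2 ^ (i + j + 1) :=
          mul_mem_pow_of_le (p := 1) (by simpa using hδ ρ) (mul_mem_pow_of_le hui hvj le_rfl)
            (by omega)
        have e1 : ρ * (e₁ * v ^ j) ∈ maxFormal 2 ^ (i + j + 1) :=
          Ideal.mul_mem_left _ _ (mul_mem_pow_of_le he₁ hvj (by omega))
        have e2 : ρ * (u ^ i * w) ∈ maxFormal 2 ^ (i + j + 1) :=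
          Ideal.mul_mem_left _ _ (mul_mem_pow_of_le hui hwm (by omega))
        have e3 : w' * s ∈ maxFormal 2 ^ (i + j + 1) := mul_mem_pow_of_le hwm' hs (by omega)
        have e4 := apply_mem_pow hδ he
        convert sub_mem hδf (add_mem (add_mem (add_mem (add_mem e0 e1) e2) e3) e4) using 1
        have hf2 : f = ρ * (u ^ i * v ^ j) + v ^ (j + 1) * s + e := by rw [h]; ring
        rw [hf2]
        simp only [map_add, Derivation.leibniz, smul_eq_mul, hu]
        rw [hw, hw', hs₁, hκ']
        ring
      refine ⟨s - C κ⁻¹ * s₁, e + C κ⁻¹ * (C κ * (ρ * u ^ i * v ^ j) + v ^ (j + 1) * s₁),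
        ?_, add_mem he (Ideal.mul_mem_left _ _ hδf'), ?_⟩
      · rw [show i + j - (j + 1) = i - 1 by omega]
        exact sub_mem hs (Ideal.mul_mem_left _ _ hs₁m)
      · rw [h]
        linear_combination (-ρ * u ^ i * v ^ j) * hκκ
  obtain ⟨g, e, -, he, rfl⟩ := key (d + 1) le_rfl
  exact hf' (add_mem (Ideal.mul_mem_right _ _ (Ideal.pow_mem_pow T.v_mem _)) he)

/-! ### The formal separatrix -/

/-- One step of the construction of the invariant curve: the error term of degree `n` is removed
by adding a multiple of `u ^ n`, which is possible when `n α ≠ β`. -/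
theorem separatrix_step (T : IsTriangular δ u v α β ε) {n : ℕ}
    (hn : 2 ≤ n) (hres : (n : ℂ) * α - β ≠ 0) {h γ : Formal 2} (hh : h - v ∈ maxFormal 2 ^ 2)
    (hγ : γ - C β ∈ maxFormal 2) (herr : δ h - γ * h ∈ maxFormal 2 ^ n) :
    ∃ h' γ', h' - h ∈ maxFormal 2 ^ n ∧ γ' - γ ∈ maxFormal 2 ^ (n - 1) ∧
      δ h' - γ' * h' ∈ maxFormal 2 ^ (n + 1) := by
  obtain ⟨ρ, s, hs, hr⟩ := T.exists_eq_of_mem_pow herr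
  obtain ⟨t, e, ht, he, hu⟩ := T.map_u_pow n
  have hun := Ideal.pow_mem_pow T.u_mem n
  -- the value of `c` for which the terms in `u ^ n` cancel
  set c : ℂ := -constantCoeff ρ / (n * α - β) with hc
  refine ⟨h + C c * u ^ n, γ + s + C c * t, ?_, ?_, ?_⟩
  · simpa using Ideal.mul_mem_left _ _ hun
  · rw [show γ + s + C c * t - γ = s + C c * t by ring]
    exact add_mem hs (Ideal.mul_mem_left _ _ ht)
  · have hc' : C (σ := Fin 2) (constantCoeff ρ) + C c * C (n * α) - C c * C β = 0 := by
      have : constantCoeff ρ + c * (n * α) - c * β = 0 := by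
        rw [hc]
        field_simp
        ring
      rw [← map_mul, ← map_mul, ← map_add, ← map_sub, this, map_zero]
    have hst : s + C c * t ∈ maxFormal 2 ^ (n - 1) := add_mem hs (Ideal.mul_mem_left _ _ ht)
    have e1 : (ρ - C (constantCoeff ρ)) * u ^ n ∈ maxFormal 2 ^ (n + 1) :=
      mul_mem_pow_of_le (p := 1) (by simpa using sub_C_mem_maxFormal ρ) hun (by omega)
    have e2 : (s + C c * t) * (h - v) ∈ maxFormal 2 ^ (n + 1) :=
      mul_mem_pow_of_le hst hh (by omega)
    have e3 : C c * e ∈ maxFormal 2 ^ (n + 1) := Ideal.mul_mem_left _ _ he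
    have e4 : C c * ((γ - C β) * u ^ n) ∈ maxFormal 2 ^ (n + 1) :=
      Ideal.mul_mem_left _ _ (mul_mem_pow_of_le (p := 1) (by simpa using hγ) hun (by omega))
    have e5 : C c * ((s + C c * t) * u ^ n) ∈ maxFormal 2 ^ (n + 1) :=
      Ideal.mul_mem_left _ _ (mul_mem_pow_of_le hst hun (by omega))
    convert sub_mem (sub_mem (add_mem (sub_mem e1 e2) e3) e4) e5 using 1
    rw [map_add, derivation_C_mul, hu]
    linear_combination hr + u ^ n * hc'

/-- In the absence of resonances `n α = β`, the eigenvector `v` of the linear part extends to a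
smooth formal curve invariant under `δ`. -/
theorem exists_separatrix (T : IsTriangular δ u v α β ε) (hδ : ∀ g, δ g ∈ maxFormal 2)
    (hres : ∀ n : ℕ, 2 ≤ n → (n : ℂ) * α - β ≠ 0) :
    ∃ h γ, δ h = γ * h ∧ h - v ∈ maxFormal 2 ^ 2 ∧ γ - C β ∈ maxFormal 2 := by
  let Inv : ℕ → Formal 2 × Formal 2 → Prop := fun n p =>
    p.1 - v ∈ maxFormal 2 ^ 2 ∧ p.2 - C β ∈ maxFormal 2 ∧
      δ p.1 - p.2 * p.1 ∈ maxFormal 2 ^ (n + 2)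
  have step : ∀ n p, Inv n p → ∃ q, Inv (n + 1) q ∧ q.1 - p.1 ∈ maxFormal 2 ^ (n + 2) ∧
      q.2 - p.2 ∈ maxFormal 2 ^ (n + 1) := by
    rintro n ⟨h, γ⟩ ⟨hh, hγ, herr⟩
    obtain ⟨h', γ', h1, h2, h3⟩ :=
      T.separatrix_step (by omega) (hres (n + 2) (by omega)) hh hγ herr
    refine ⟨(h', γ'), ⟨?_, ?_, h3⟩, h1, h2⟩
    · simpa using add_mem (Ideal.pow_le_pow_right (by omega) h1) hh
    · have := add_mem (Ideal.pow_le_self (by omega) h2) hγ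
      simpa using this
  choose! F hF using step
  let S : ℕ → Formal 2 × Formal 2 := fun n => Nat.rec (v, C β) (fun n p => F n p) n
  have hS : ∀ n, Inv n (S n) := by
    intro n
    induction n with
    | zero => exact ⟨by simp [S], by simp [S], T.map_v⟩
    | succ n ih => exact (hF n _ ih).1
  obtain ⟨h, hh⟩ := exists_limit_of_sub_mem (fun n => (S n).1) 0 fun n _ =>
    Ideal.pow_le_pow_right (by omega) (hF n _ (hS n)).2.1
  obtain ⟨γ, hγ⟩ := exists_limit_of_sub_mem (fun n => (S n).2) 0 fun n _ =>
    Ideal.pow_le_pow_right (by omega) (hF n _ (hS n)).2.2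
  refine ⟨h, γ, ?_, ?_, ?_⟩
  · rw [← sub_eq_zero]
    refine eq_zero_of_forall_mem_pow fun n => ?_
    have h1 := apply_mem_pow hδ (hh n (Nat.zero_le _))
    have h2 := Ideal.mul_mem_left _ γ (hh n (Nat.zero_le _))
    have h3 := Ideal.mul_mem_right (S n).1 _ (hγ n (Nat.zero_le _))
    have h4 := Ideal.pow_le_pow_right (show n ≤ n + 2 by omega) (hS n).2.2
    convert add_mem (sub_mem (sub_mem h1 h2) h3) h4 using 1
    rw [map_sub]
    ring
  · simpa using add_mem (hh 2 (Nat.zero_le _)) (hS 2).1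
  · have := add_mem (hγ 1 (Nat.zero_le _)) (by simpa using (hS 1).2.1)
    simpa using this

/-- An eigenfunction of `δ` whose eigenvalue differs from every `i α` in question restricts to `0`
on the invariant curve `h = 0`. -/
theorem separatrix_dvd (T : IsTriangular δ u v α β ε) (hδ : ∀ g, δ g ∈ maxFormal 2)
    {h γ g θ : Formal 2} (hh : δ h = γ * h) (hv : h - v ∈ maxFormal 2 ^ 2) (hg : δ g = θ * g)
    {k : ℕ} (hk : g ∈ maxFormal 2 ^ k)
    (hθ : ∀ i : ℕ, k ≤ i → (i : ℂ) * α - constantCoeff θ ≠ 0) : h ∣ g := by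
  -- the restriction of `g` to the curve vanishes to every order
  have key : ∀ i, k ≤ i → g ∈ Ideal.span {h} ⊔ maxFormal 2 ^ i := by
    intro i hi
    induction i, hi using Nat.le_induction with
    | base => exact Ideal.mem_sup_right hk
    | succ i hi ih =>
      obtain ⟨a, ha, r, hr, rfl⟩ := Submodule.mem_sup.1 ih
      obtain ⟨b, rfl⟩ := Ideal.mem_span_singleton.1 ha
      obtain ⟨ρ, s, hs, rfl⟩ := T.exists_eq_of_mem_pow hr
      obtain ⟨t, e, ht, he, hu⟩ := T.map_u_pow i
      have hui := Ideal.pow_mem_pow T.u_mem i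
      set J := Ideal.span {h} ⊔ maxFormal 2 ^ (i + 1) with hJ
      have hhJ : ∀ q, h * q ∈ J := fun q =>
        Ideal.mul_mem_right _ _ (Ideal.mem_sup_left (Ideal.mem_span_singleton_self h))
      have hmJ : ∀ q ∈ maxFormal 2 ^ (i + 1), q ∈ J := fun q hq => Ideal.mem_sup_right hq
      have hvJ : ∀ q ∈ maxFormal 2 ^ (i - 1), v * q ∈ J := by
        intro q hq
        have h1 : (h - v) * q ∈ J := hmJ _ (mul_mem_pow_of_le hv hq (by omega))
        convert sub_mem (hhJ q) h1 using 1
        ring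
      have hκ := hθ i hi
      set κ : ℂ := i * α - constantCoeff θ with hκdef
      have hκκ : C (σ := Fin 2) κ⁻¹ * C κ = 1 := by rw [← map_mul, inv_mul_cancel₀ hκ, map_one]
      have hκ' : C (σ := Fin 2) κ = C (i * α) - C (constantCoeff θ) := by rw [← map_sub]
      have hmain : C κ * (ρ * u ^ i) ∈ J := by
        have e1 : δ ρ * u ^ i ∈ J :=
          hmJ _ (mul_mem_pow_of_le (p := 1) (by simpa using hδ ρ) hui (by omega))
        have e2 : v * (ρ * t + δ s - θ * s) ∈ J :=
          hvJ _ (sub_mem (add_mem (Ideal.mul_mem_left _ _ ht) (apply_mem_pow hδ hs))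
            (Ideal.mul_mem_left _ _ hs))
        have e3 : ρ * e ∈ J := Ideal.mul_mem_left _ _ (hmJ _ he)
        have e4 : ρ * ((θ - C (constantCoeff θ)) * u ^ i) ∈ J :=
          Ideal.mul_mem_left _ _ (hmJ _ (mul_mem_pow_of_le (p := 1)
            (by simpa using sub_C_mem_maxFormal θ) hui (by omega)))
        have e5 : (δ v - C β * v) * s ∈ J :=
          hmJ _ (mul_mem_pow_of_le T.map_v hs (by omega))
        have e6 : C β * (v * s) ∈ J := Ideal.mul_mem_left _ _ (hvJ s hs)
        have e7 := hhJ (δ b + γ * b - θ * b)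
        have := add_mem (add_mem (add_mem (sub_mem (add_mem (add_mem e1 e2) e3) e4) e5) e6) e7
        rw [← neg_mem_iff]
        convert this using 1
        simp only [map_add, Derivation.leibniz, smul_eq_mul, hu, hh] at hg
        rw [hκ']
        linear_combination -hg
      have hmain' := Ideal.mul_mem_left _ (C κ⁻¹) hmain
      rw [← mul_assoc, hκκ, one_mul] at hmain'
      exact add_mem (hhJ b) (add_mem hmain' (hvJ s hs))
  refine dvd_of_forall_mem_sup fun i => ?_
  rcases le_total k i with hi | hi
  · exact key i hi
  · have hle : maxFormal 2 ^ k ≤ maxFormal 2 ^ i := Ideal.pow_le_pow_right hi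
    exact (sup_le_sup le_rfl hle : Ideal.span {h} ⊔ _ ≤ Ideal.span {h} ⊔ _) (key k le_rfl)

/-- A resonance `p α + q β = 0` of order `p + q = d` with `q ≥ 2` forces an eigenfunction of order
`d` to vanish at least doubly along the invariant curve tangent to `v = 0`. -/
theorem exists_sq_dvd (T : IsTriangular δ u v α β ε) (hδ : ∀ g, δ g ∈ maxFormal 2)
    {f a : Formal 2} (ha : a ∈ maxFormal 2) (hδf : δ f = a * f) {p q : ℕ}
    (hf : f ∈ maxFormal 2 ^ (p + q)) (hrel : (p : ℂ) * α + q * β = 0) (hq : 2 ≤ q) (hα : α ≠ 0) :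
    ∃ h ∈ maxFormal 2, h * h ∣ f := by
  have hq0 : (q : ℂ) ≠ 0 := by
    simp only [ne_eq, Nat.cast_eq_zero]
    omega
  -- the only order of vanishing along the curve compatible with the eigenvalue `-β` is `p / q`
  have hnat : ∀ i : ℕ, (i : ℂ) * α + β = 0 → i * q = p := by
    intro i hi
    have : ((i * q : ℕ) : ℂ) = p := by
      apply mul_right_cancel₀ hα
      push_cast
      linear_combination q * hi - hrel
    exact_mod_cast this
  obtain ⟨h, γ, hh, hv, hγ⟩ := T.exists_separatrix hδ fun n hn h0 => by
    have : ((n * q + p : ℕ) : ℂ) = 0 := by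
      apply mul_right_cancel₀ hα
      push_cast
      linear_combination q * h0 + hrel
    have h1 : n * q + p = 0 := by exact_mod_cast this
    have : 0 < n * q := by positivity
    omega
  have hhm : h ∈ maxFormal 2 := by
    have := add_mem (Ideal.pow_le_self (by omega) hv) T.v_mem
    simpa using this
  have hh2 : h ∉ maxFormal 2 ^ 2 := fun h2 => T.v_notMem (by simpa using sub_mem h2 hv)
  have hh0 : h ≠ 0 := fun h0 => hh2 (by rw [h0]; exact zero_mem _)
  obtain ⟨g, rfl⟩ := T.separatrix_dvd hδ hh hv hδf hf fun i hi => by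
    rw [mem_maxFormal_iff.1 ha, sub_zero]
    have : i ≠ 0 := by omega
    positivity
  have hgm : g ∈ maxFormal 2 ^ (p + q - 1) := by
    rw [mem_maxFormal_pow_iff] at hf hh2 ⊢
    rw [order_mul] at hf
    rw [not_le, Nat.cast_ofNat] at hh2
    have h1 : h.order ≤ 1 := Order.le_of_lt_add_one (by simpa [one_add_one_eq_two] using hh2)
    have h2 := hf.trans (add_le_add_left h1 g.order)
    rw [show p + q = 1 + (p + q - 1) by omega] at h2
    push_cast at h2
    exact (ENat.add_le_add_iff_left (by simp)).1 h2
  have hδg : δ g = (a - γ) * g := by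
    rw [Derivation.leibniz, hh, smul_eq_mul, smul_eq_mul] at hδf
    exact mul_left_cancel₀ hh0 (by linear_combination hδf)
  refine ⟨h, hhm, mul_dvd_mul_left h (T.separatrix_dvd hδ hh hv hδg hgm fun i hi h0 => ?_)⟩
  have hγ0 : constantCoeff γ = β := by
    have := mem_maxFormal_iff.1 hγ
    simpa [sub_eq_zero] using this
  rw [map_sub, mem_maxFormal_iff.1 ha, hγ0] at h0
  have h1 := hnat i (by linear_combination h0)
  have : i * 2 ≤ i * q := Nat.mul_le_mul_left i hq
  omega

end IsTriangular

/-- Let `f` be an eigenfunction, of order at least `3` and with eigenvalue in `𝔪`, of a singular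
derivation `δ` of `ℂ[[x, y]]`. If `δ` is not topologically nilpotent, then `f` has a multiple
factor. -/
theorem exists_sq_dvd_of_not_isTopNilpotent {δ : Derivation ℂ (Formal 2) (Formal 2)}
    (hδ : ∀ g, δ g ∈ maxFormal 2) {f a : Formal 2} (ha : a ∈ maxFormal 2) (hδf : δ f = a * f)
    (hf0 : f ≠ 0) (hf : f ∈ maxFormal 2 ^ 3) (hnil : ¬ IsTopNilpotent δ) :
    ∃ h ∈ maxFormal 2, h * h ∣ f := by
  obtain ⟨a₀, b₀, hx⟩ := exists_linear_part (hδ (X 0))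
  obtain ⟨c₀, e₀, hy⟩ := exists_linear_part (hδ (X 1))
  -- an eigenvalue of the linear part, by the quadratic formula
  obtain ⟨μ, hμ⟩ : ∃ μ : ℂ, (a₀ - μ) * (e₀ - μ) = b₀ * c₀ := by
    obtain ⟨s, hs⟩ := IsAlgClosed.exists_pow_nat_eq ((a₀ - e₀) ^ 2 + 4 * (b₀ * c₀)) (n := 2)
      (by norm_num)
    exact ⟨(a₀ + e₀ + s) / 2, by linear_combination hs / 4⟩
  obtain ⟨u, v, ε, T⟩ := exists_isTriangular hx hy hμ
  obtain ⟨u', v', ε', T'⟩ := exists_isTriangular hx hy (μ := a₀ + e₀ - μ)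
    (by linear_combination hμ)
  rw [sub_sub_cancel] at T'
  obtain ⟨d, hd⟩ : ∃ d : ℕ, (d : ℕ∞) = f.order := ⟨_, ne_zero_iff_order_finite.1 hf0⟩
  have hfd : f ∈ maxFormal 2 ^ d := mem_maxFormal_pow_iff.2 hd.le
  have hfd' : f ∉ maxFormal 2 ^ (d + 1) := by
    rw [mem_maxFormal_pow_iff, ← hd, not_le]
    exact_mod_cast Nat.lt_succ_self d
  have h3d : 3 ≤ d := by
    rw [mem_maxFormal_pow_iff, ← hd] at hf
    exact_mod_cast hf
  obtain ⟨i, j, hij, hrel⟩ := T.exists_relation hδ hfd hfd' (by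
    rw [hδf, pow_succ']
    exact Ideal.mul_mem_mul ha hfd)
  set ν := a₀ + e₀ - μ with hν
  -- both eigenvalues zero: nilpotent; otherwise the exponent of one eigenvector is at least `2`
  -- and the other eigenvalue does not vanish
  rcases eq_or_ne ν 0 with h1 | h1 <;> rcases eq_or_ne μ 0 with h2 | h2
  · refine absurd (isTopNilpotent_of_sq hδ fun g hg => ?_) hnil
    obtain ⟨r, s, rfl⟩ := T.mem_span g hg
    have hu := T.map_u
    have hv := T.map_v
    rw [h1, map_zero, zero_mul, zero_add] at hu
    rw [h2, map_zero, zero_mul, sub_zero] at hv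
    have hvm : ∀ r, δ (r * v) ∈ maxFormal 2 ^ 2 := fun r => by
      rw [Derivation.leibniz, smul_eq_mul, smul_eq_mul]
      refine add_mem (Ideal.mul_mem_left _ _ hv) ?_
      rw [sq]
      exact Ideal.mul_mem_mul T.v_mem (hδ r)
    have hur : δ (r * u) - r * C ε * v ∈ maxFormal 2 ^ 2 := by
      have := Ideal.mul_mem_mul T.u_mem (hδ r)
      rw [← sq] at this
      convert add_mem (Ideal.mul_mem_left _ r hu) this using 1
      rw [Derivation.leibniz, smul_eq_mul, smul_eq_mul]
      ring
    have h3 := apply_mem_pow hδ (add_mem hur (hvm s))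
    have h4 := hvm (r * C ε)
    convert add_mem h3 h4 using 1
    simp only [map_add, map_sub]
    ring
  · rw [h1, mul_zero, zero_add, mul_eq_zero, or_iff_left h2] at hrel
    refine T'.exists_sq_dvd hδ ha hδf (p := j) (q := i) (by rwa [add_comm, hij])
      (by rw [h1, hrel]; ring) ?_ h2
    have : j = 0 := by exact_mod_cast hrel
    omega
  · rw [h2, mul_zero, add_zero, mul_eq_zero, or_iff_left h1] at hrel
    refine T.exists_sq_dvd hδ ha hδf (p := i) (q := j) (by rwa [hij])
      (by rw [h2, hrel]; ring) ?_ h1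
    have : i = 0 := by exact_mod_cast hrel
    omega
  · rcases le_or_gt 2 j with hj | hj
    · exact T.exists_sq_dvd hδ ha hδf (by rwa [hij]) hrel hj h1
    · exact T'.exists_sq_dvd hδ ha hδf (p := j) (q := i) (by rwa [add_comm, hij])
        (by linear_combination hrel) (by omega) h2

open scoped NNReal ENNReal

/-! ### Weighted norms and Weierstrass division for convergent series -/

/-- The value of the monomial with exponent `a` at the point `w`. -/
noncomputable def monomialValue {n : ℕ} (w : Fin n → ℝ≥0) (a : Fin n →₀ ℕ) : ℝ≥0∞ :=
  ∏ i, (w i : ℝ≥0∞) ^ a i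

/-- The weighted `ℓ¹` norm of a power series for the polyradius `w`, with values in `[0, ∞]`. -/
noncomputable def wnorm {n : ℕ} (w : Fin n → ℝ≥0) (f : Formal n) : ℝ≥0∞ :=
  ∑' a, ‖coeff a f‖ₑ * monomialValue w a

section wnorm

variable {n : ℕ} {w : Fin n → ℝ≥0}

theorem monomialValue_add (a b : Fin n →₀ ℕ) :
    monomialValue w (a + b) = monomialValue w a * monomialValue w b := by
  simp [monomialValue, pow_add, Finset.prod_mul_distrib]

theorem monomialValue_single (i : Fin n) (d : ℕ) :
    monomialValue w (single i d) = (w i : ℝ≥0∞) ^ d := by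
  rw [monomialValue, Finset.prod_eq_single i]
  · simp
  · intro j _ hj
    simp [hj.symm]
  · simp

theorem monomialValue_ne_zero (hw : ∀ i, w i ≠ 0) (a : Fin n →₀ ℕ) : monomialValue w a ≠ 0 :=
  Finset.prod_ne_zero_iff.2 fun i _ => pow_ne_zero _ (by simpa using hw i)

theorem wnorm_add_le (f g : Formal n) : wnorm w (f + g) ≤ wnorm w f + wnorm w g := by
  rw [wnorm, wnorm, wnorm, ← ENNReal.tsum_add]
  refine ENNReal.tsum_le_tsum fun a => ?_
  rw [map_add, ← add_mul]
  gcongr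
  exact enorm_add_le _ _

theorem wnorm_le_of_forall_coeff {f g : Formal n}
    (h : ∀ a, coeff a f = 0 ∨ coeff a f = coeff a g) :
    wnorm w f ≤ wnorm w g := by
  refine ENNReal.tsum_le_tsum fun a => ?_
  rcases h a with h | h
  · simp [h]
  · rw [h]

theorem wnorm_mono {w' : Fin n → ℝ≥0} (h : ∀ i, w i ≤ w' i) (f : Formal n) :
    wnorm w f ≤ wnorm w' f := by
  refine ENNReal.tsum_le_tsum fun a => mul_le_mul_right ?_ _
  exact Finset.prod_le_prod' fun i _ => pow_le_pow_left' (by exact_mod_cast h i) _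

theorem wnorm_mul_le (f g : Formal n) : wnorm w (f * g) ≤ wnorm w f * wnorm w g := by
  classical
  have h : wnorm w f * wnorm w g = ∑' a, ∑ p ∈ Finset.HasAntidiagonal.antidiagonal a,
      (‖coeff p.1 f‖ₑ * monomialValue w p.1) * (‖coeff p.2 g‖ₑ * monomialValue w p.2) := by
    rw [wnorm, wnorm, ← ENNReal.tsum_mul_right]
    simp_rw [← ENNReal.tsum_mul_left]
    rw [← ENNReal.tsum_prod, ← Finset.HasAntidiagonal.sigmaAntidiagonalEquivProd.tsum_eq,
      ENNReal.tsum_sigma']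
    refine tsum_congr fun a => ?_
    rw [tsum_fintype]
    exact Finset.sum_coe_sort (Finset.HasAntidiagonal.antidiagonal a) fun p =>
      (‖coeff p.1 f‖ₑ * monomialValue w p.1) * (‖coeff p.2 g‖ₑ * monomialValue w p.2)
  rw [h]
  refine ENNReal.tsum_le_tsum fun a => ?_
  rw [coeff_mul]
  refine (mul_le_mul_left (enorm_sum_le _ _) _).trans ?_
  rw [Finset.sum_mul]
  refine Finset.sum_le_sum fun p hp => le_of_eq ?_
  rw [← Finset.HasAntidiagonal.mem_antidiagonal.1 hp, monomialValue_add, enorm_mul]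
  ring

theorem wnorm_X_pow_mul_le (i : Fin n) (d : ℕ) (f : Formal n) :
    wnorm w (X i ^ d * f) ≤ (w i : ℝ≥0∞) ^ d * wnorm w f := by
  classical
  refine (wnorm_mul_le _ _).trans (mul_le_mul_left (le_of_eq ?_) _)
  rw [wnorm, tsum_eq_single (single i d)]
  · rw [coeff_X_pow, if_pos rfl, enorm_one, one_mul, monomialValue_single]
  · intro a ha
    rw [coeff_X_pow, if_neg ha, enorm_zero, zero_mul]

theorem wnorm_C_mul (c : ℂ) (f : Formal n) : wnorm w (C c * f) = ‖c‖ₑ * wnorm w f := by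
  rw [wnorm, wnorm, ← ENNReal.tsum_mul_left]
  refine tsum_congr fun a => ?_
  rw [coeff_C_mul, enorm_mul, mul_assoc]

theorem wnorm_shift_le (i : Fin n) (d : ℕ) (f : Formal n) :
    (w i : ℝ≥0∞) ^ d * wnorm w (shift i d f) ≤ wnorm w f := by
  rw [wnorm, ← ENNReal.tsum_mul_left]
  refine le_trans (le_of_eq (tsum_congr fun a => ?_)) (ENNReal.tsum_comp_le_tsum_of_injective
    (add_left_injective (single i d)) fun a => ‖coeff a f‖ₑ * monomialValue w a)
  rw [coeff_shift, monomialValue_add, monomialValue_single]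
  ring

theorem wnorm_shift_lt_top (hw : ∀ i, w i ≠ 0) (i : Fin n) (d : ℕ) {f : Formal n}
    (hf : wnorm w f < ∞) : wnorm w (shift i d f) < ∞ := by
  have h := (wnorm_shift_le i d f).trans_lt hf
  refine ENNReal.lt_top_of_mul_ne_top_right h.ne ?_
  exact pow_ne_zero _ (by simpa using hw i)

theorem wnorm_setZero_le (i : Fin n) (f : Formal n) : wnorm w (setZero i f) ≤ wnorm w f := by
  refine wnorm_le_of_forall_coeff fun a => ?_
  rw [coeff_setZero]
  split_ifs
  · exact Or.inr rfl
  · exact Or.inl rfl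

theorem convergesAt_iff_wnorm (f : Formal n) (r : ℝ≥0) :
    ConvergesAt f r ↔ wnorm (fun _ => r) f < ∞ := by
  have h : wnorm (fun _ => r) f
      = ∑' a : Fin n →₀ ℕ, ((‖coeff a f‖₊ * r ^ a.degree : ℝ≥0) : ℝ≥0∞) := by
    refine tsum_congr fun a => ?_
    rw [monomialValue, Finset.prod_pow_eq_pow_sum, ← degree_eq_sum]
    push_cast
    rfl
  rw [h, lt_top_iff_ne_top, ENNReal.tsum_coe_ne_top_iff_summable, ← NNReal.summable_coe,
    ConvergesAt]
  push_cast
  rfl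

theorem mem_convergent_iff (f : Formal n) :
    f ∈ convergent n ↔ ∃ r : ℝ≥0, 0 < r ∧ wnorm (fun _ => r) f < ∞ := by
  constructor
  · rintro ⟨r, hr, h⟩
    lift r to ℝ≥0 using hr.le
    exact ⟨r, by exact_mod_cast hr, (convergesAt_iff_wnorm f r).1 h⟩
  · rintro ⟨r, hr, h⟩
    exact ⟨r, by exact_mod_cast hr, (convergesAt_iff_wnorm f r).2 h⟩

theorem shift_mem_convergent (i : Fin n) (d : ℕ) {f : Formal n} (hf : f ∈ convergent n) :
    shift i d f ∈ convergent n := by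
  rw [mem_convergent_iff] at hf ⊢
  obtain ⟨r, hr, h⟩ := hf
  exact ⟨r, hr, wnorm_shift_lt_top (fun _ => hr.ne') i d h⟩

theorem setZero_mem_convergent (i : Fin n) {f : Formal n} (hf : f ∈ convergent n) :
    setZero i f ∈ convergent n :=
  sub_mem hf (mul_mem (X_mem_convergent i) (shift_mem_convergent i 1 hf))

/-- The affine map `q ↦ g + shift i d (e * q)` is a contraction for the weighted norm as soon as
`e` is small compared with `wᵢ ^ d`; its fixed point is the sum of the Neumann series. -/
theorem exists_eq_add_shift_mul (hw : ∀ i, w i ≠ 0) (i : Fin n) (d : ℕ) {e g : Formal n}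
    (he : 2 * wnorm w e ≤ (w i : ℝ≥0∞) ^ d) (hg : wnorm w g < ∞) :
    ∃ q, wnorm w q < ∞ ∧ q = g + shift i d (e * q) := by
  classical
  obtain ⟨Q, hQ0, hQs⟩ : ∃ Q : ℕ → Formal n, Q 0 = g ∧ ∀ k, Q (k + 1) = shift i d (e * Q k) :=
    ⟨fun k => (fun q => shift i d (e * q))^[k] g, rfl,
      fun k => Function.iterate_succ_apply' _ _ _⟩
  have hwd0 : (w i : ℝ≥0∞) ^ d ≠ 0 := pow_ne_zero _ (by simpa using hw i)
  have hwdt : (w i : ℝ≥0∞) ^ d ≠ ∞ := ENNReal.pow_ne_top ENNReal.coe_ne_top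
  -- the terms of the Neumann series decrease geometrically
  have hstep : ∀ k, 2 * wnorm w (Q (k + 1)) ≤ wnorm w (Q k) := by
    intro k
    rw [← ENNReal.mul_le_mul_iff_right hwd0 hwdt, hQs]
    calc (w i : ℝ≥0∞) ^ d * (2 * wnorm w (shift i d (e * Q k)))
        = 2 * ((w i : ℝ≥0∞) ^ d * wnorm w (shift i d (e * Q k))) := by ring
      _ ≤ 2 * (wnorm w e * wnorm w (Q k)) :=
        mul_le_mul_right ((wnorm_shift_le i d _).trans (wnorm_mul_le _ _)) _
      _ = (2 * wnorm w e) * wnorm w (Q k) := by ring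
      _ ≤ (w i : ℝ≥0∞) ^ d * wnorm w (Q k) := mul_le_mul_left he _
  have hQ : ∀ k, wnorm w (Q k) ≤ 2⁻¹ ^ k * wnorm w g := by
    intro k
    induction k with
    | zero => simp [hQ0]
    | succ k ih =>
      have h2 : wnorm w (Q (k + 1)) = 2⁻¹ * (2 * wnorm w (Q (k + 1))) := by
        rw [← mul_assoc, ENNReal.inv_mul_cancel (by norm_num) (by norm_num), one_mul]
      rw [h2, pow_succ', mul_assoc]
      exact mul_le_mul_right ((hstep k).trans ih) _
  have hsum : ∑' k, wnorm w (Q k) < ∞ := by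
    refine (ENNReal.tsum_le_tsum hQ).trans_lt ?_
    rw [ENNReal.tsum_mul_right, ENNReal.tsum_geometric_two]
    exact ENNReal.mul_lt_top (by norm_num) hg
  have hswap : ∑' a, (∑' k, ‖coeff a (Q k)‖ₑ) * monomialValue w a = ∑' k, wnorm w (Q k) := by
    simp_rw [wnorm, ← ENNReal.tsum_mul_right]
    rw [ENNReal.tsum_comm]
  have hsummable : ∀ a, Summable fun k => coeff a (Q k) := by
    intro a
    have h1 : (∑' k, ‖coeff a (Q k)‖ₑ) * monomialValue w a < ∞ :=
      (ENNReal.le_tsum a).trans_lt (hswap.trans_lt hsum)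
    have h2 := ENNReal.lt_top_of_mul_ne_top_left h1.ne (monomialValue_ne_zero hw a)
    have h3 : Summable fun k => ‖coeff a (Q k)‖₊ :=
      ENNReal.tsum_coe_ne_top_iff_summable.1 h2.ne
    exact Summable.of_nnnorm h3
  obtain ⟨q, hq⟩ : ∃ q : Formal n, ∀ a, coeff a q = ∑' k, coeff a (Q k) :=
    ⟨fun a => ∑' k, coeff a (Q k), fun _ => rfl⟩
  refine ⟨q, lt_of_le_of_lt ?_ hsum, ?_⟩
  · rw [← hswap]
    refine ENNReal.tsum_le_tsum fun a => mul_le_mul_left ?_ _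
    rw [hq]
    exact enorm_tsum_le_tsum_enorm
  · ext a
    rw [hq, (hsummable a).tsum_eq_zero_add, map_add, hQ0, coeff_shift, coeff_mul]
    congr 1
    simp_rw [hQs, coeff_shift, coeff_mul]
    have hs : ∀ p ∈ Finset.HasAntidiagonal.antidiagonal (a + single i d),
        Summable fun k => coeff p.1 e * coeff p.2 (Q k) :=
      fun p _ => (hsummable p.2).mul_left (coeff p.1 e)
    refine (Summable.tsum_finsetSum hs).trans ?_
    refine Finset.sum_congr rfl fun p _ => ?_
    rw [tsum_mul_left, hq]

end wnorm

/-- Weierstrass division in `ℂ{x, y}`: if `f(0, y)` has order `d`, then every convergent series is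
a multiple of `f` up to a polynomial of degree less than `d` in `y`. The polydisc is chosen thin in
the direction of `x`, so that `f` is close to its leading term `c y ^ d`. -/
theorem exists_weierstrass_division {f g : Formal 2} (hf : f ∈ convergent 2)
    (hg : g ∈ convergent 2) {d : ℕ} (h0 : ∀ a : Fin 2 →₀ ℕ, a 0 = 0 → a 1 < d → coeff a f = 0)
    (hd : coeff (single 1 d) f ≠ 0) : ∃ q ∈ convergent 2, shift 1 d (g - f * q) = 0 := by
  classical
  rw [mem_convergent_iff] at hf hg
  obtain ⟨r₁, hr₁, hf⟩ := hf
  obtain ⟨r₂, hr₂, hg⟩ := hg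
  set ρ := min r₁ r₂ with hρ
  have hρ0 : 0 < ρ := lt_min hr₁ hr₂
  replace hf := (wnorm_mono (w := fun _ => ρ) (fun _ => min_le_left _ _) f).trans_lt hf
  replace hg := (wnorm_mono (w := fun _ => ρ) (fun _ => min_le_right _ _) g).trans_lt hg
  set c := coeff (single 1 d) f with hc
  set u := shift 0 1 f with hu
  set v := shift 1 (d + 1) (setZero 0 f) with hv
  have hdecomp : f = C c * X 1 ^ d + (X 0 ^ 1 * u + X 1 ^ (d + 1) * v) := by
    ext a
    rw [map_add, map_add, hu, hv, coeff_X_pow_mul_shift, coeff_X_pow_mul_shift, coeff_C_mul,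
      coeff_X_pow, coeff_setZero]
    rcases Nat.eq_zero_or_pos (a 0) with ha | ha
    · have hne : ¬ 1 ≤ a 0 := by omega
      rw [if_neg hne, if_pos ha, zero_add]
      rcases lt_trichotomy (a 1) d with hlt | heq | hgt
      · rw [if_neg (by omega : ¬ d + 1 ≤ a 1), if_neg (fun h => by simp [h] at hlt), h0 a ha hlt]
        simp
      · have : a = single 1 d := by
          ext i
          fin_cases i
          · simpa using ha
          · simpa using heq
        rw [if_pos this, if_neg (by omega : ¬ d + 1 ≤ a 1), this, hc]
        simp
      · rw [if_pos (by omega : d + 1 ≤ a 1), if_neg (fun h => by simp [h] at hgt)]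
        simp
    · rw [if_pos (by omega : 1 ≤ a 0), if_neg (by omega : ¬ a 0 = 0),
        if_neg (fun h => by simp [h] at ha)]
      simp
  have hU := wnorm_shift_lt_top (fun _ => hρ0.ne') 0 1 hf
  have hV := wnorm_shift_lt_top (fun _ => hρ0.ne') 1 (d + 1)
    ((wnorm_setZero_le 0 f).trans_lt hf)
  rw [← hu] at hU
  rw [← hv] at hV
  lift wnorm (fun _ => ρ) u to ℝ≥0 using hU.ne with U hU'
  lift wnorm (fun _ => ρ) v to ℝ≥0 using hV.ne with V hV'
  set K := ‖-c⁻¹‖₊ with hK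
  -- `s` is chosen first, to make the terms in `y ^ (d + 1)` small compared with `s ^ d`, then `r`
  set s := min ρ (1 / (4 * (K * V + 1))) with hs
  have hs0 : 0 < s := lt_min hρ0 (by positivity)
  set r := min ρ (s ^ d / (4 * (K * U + 1))) with hr
  have hr0 : 0 < r := lt_min hρ0 (by positivity)
  let w : Fin 2 → ℝ≥0 := ![r, s]
  have hw : ∀ i, w i ≠ 0 := by
    intro i
    fin_cases i
    · exact hr0.ne'
    · exact hs0.ne'
  have hwρ : ∀ i, w i ≤ ρ := by
    intro i
    fin_cases i
    · exact min_le_left _ _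
    · exact min_le_left _ _
  have hsV : s * (4 * (K * V + 1)) ≤ 1 := by
    rw [← le_div_iff₀ (by positivity)]
    exact min_le_right _ _
  have hrU : r * (4 * (K * U + 1)) ≤ s ^ d := by
    rw [← le_div_iff₀ (by positivity)]
    exact min_le_right _ _
  have hsmall : 2 * (K * (r * U + s ^ (d + 1) * V)) ≤ s ^ d := by
    have h1 : 4 * (K * (r * U)) ≤ s ^ d := by
      refine le_trans ?_ hrU
      calc 4 * (K * (r * U)) = r * (4 * (K * U)) := by ring
        _ ≤ r * (4 * (K * U + 1)) := by gcongr; exact le_self_add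
    have h2 : 4 * (K * (s ^ (d + 1) * V)) ≤ s ^ d := by
      calc 4 * (K * (s ^ (d + 1) * V)) = s ^ d * (s * (4 * (K * V))) := by ring
        _ ≤ s ^ d * (s * (4 * (K * V + 1))) := by gcongr; exact le_self_add
        _ ≤ s ^ d * 1 := by gcongr
        _ = s ^ d := mul_one _
    rw [← NNReal.coe_le_coe] at h1 h2 ⊢
    push_cast at h1 h2 ⊢
    linarith
  set e := C (-c⁻¹) * (X 0 ^ 1 * u + X 1 ^ (d + 1) * v) with he
  have hesmall : 2 * wnorm w e ≤ (w 1 : ℝ≥0∞) ^ d := by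
    rw [he, wnorm_C_mul]
    have h1 : wnorm w (X 0 ^ 1 * u) ≤ (r : ℝ≥0∞) * U := by
      refine (wnorm_X_pow_mul_le 0 1 u).trans ?_
      rw [pow_one, hU']
      exact mul_le_mul_right (wnorm_mono hwρ u) _
    have h2 : wnorm w (X 1 ^ (d + 1) * v) ≤ (s : ℝ≥0∞) ^ (d + 1) * V := by
      refine (wnorm_X_pow_mul_le 1 (d + 1) v).trans ?_
      rw [hV']
      exact mul_le_mul_right (wnorm_mono hwρ v) _
    calc 2 * (‖-c⁻¹‖ₑ * wnorm w (X 0 ^ 1 * u + X 1 ^ (d + 1) * v))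
        ≤ 2 * ((K : ℝ≥0∞) * ((r : ℝ≥0∞) * U + (s : ℝ≥0∞) ^ (d + 1) * V)) := by
          refine mul_le_mul_right (mul_le_mul_right ?_ _) _
          exact (wnorm_add_le _ _).trans (add_le_add h1 h2)
      _ ≤ (w 1 : ℝ≥0∞) ^ d := by exact_mod_cast hsmall
  have hgw : wnorm w (shift 1 d (C c⁻¹ * g)) < ∞ := by
    refine wnorm_shift_lt_top hw 1 d ?_
    rw [wnorm_C_mul]
    exact ENNReal.mul_lt_top enorm_lt_top ((wnorm_mono hwρ g).trans_lt hg)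
  obtain ⟨q, hq, hqe⟩ := exists_eq_add_shift_mul hw 1 d hesmall hgw
  refine ⟨q, ?_, ?_⟩
  · rw [mem_convergent_iff]
    refine ⟨min r s, lt_min hr0 hs0, (wnorm_mono (fun i => ?_) q).trans_lt hq⟩
    fin_cases i
    · exact min_le_left _ _
    · exact min_le_right _ _
  · have hcc : C (σ := Fin 2) c * C c⁻¹ = 1 := by rw [← map_mul, mul_inv_cancel₀ hd, map_one]
    have h1 : g - f * q = C c * (C c⁻¹ * g + e * q - X 1 ^ d * q) := by
      rw [he, hdecomp, map_neg]
      linear_combination (-g + (X 0 ^ 1 * u + X 1 ^ (d + 1) * v) * q) * hcc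
    rw [h1, ← smul_eq_C_mul, map_smul, map_sub, map_add, shift_X_pow_mul, ← hqe, sub_self,
      smul_zero]

/-! ### Weierstrass polynomials over the discrete valuation ring of convergent series in `x` -/

instance (n : ℕ) : IsDomain (Formal n) := NoZeroDivisors.to_isDomain _

/-- The inverse is the quotient of the Weierstrass division of `1` by `b`, with `d = 0`. -/
theorem isUnit_conv_of_constantCoeff_ne_zero {b : Conv 2}
    (hb : constantCoeff (b : Formal 2) ≠ 0) : IsUnit b := by
  obtain ⟨q, hq, h⟩ := exists_weierstrass_division (f := b) (g := 1) (d := 0) b.2 (one_mem _)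
    (fun a _ ha => by omega) (by simpa using hb)
  refine IsUnit.of_mul_eq_one ⟨q, hq⟩ (Subtype.ext ?_)
  have h1 : (1 : Formal 2) - b * q = 0 := by
    ext a
    have := congrArg (coeff a) h
    rwa [coeff_shift, single_zero, add_zero] at this
  change (b : Formal 2) * q = 1
  linear_combination -h1

theorem constantCoeff_ne_zero_of_isUnit {b : Conv 2} (hb : IsUnit b) :
    constantCoeff (b : Formal 2) ≠ 0 := by
  have h := hb.map (convergent 2).val
  exact ((isUnit_iff_constantCoeff).1 h).ne_zero

/-- The ring `ℂ{x}` of convergent series in the first variable, inside `ℂ{x, y}`: the kernel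
of `∂/∂y`. -/
noncomputable def xSeries : Subalgebra ℂ (Conv 2) where
  carrier := {f | pderiv ℂ 1 (f : Formal 2) = 0}
  mul_mem' {f g} hf hg := by
    simp only [Set.mem_ofPred_eq] at hf hg ⊢
    simp [hf, hg]
  add_mem' {f g} hf hg := by
    simp only [Set.mem_ofPred_eq] at hf hg ⊢
    simp [hf, hg]
  algebraMap_mem' c := by
    change pderiv ℂ 1 (algebraMap ℂ (Formal 2) c) = 0
    simp

theorem mem_xSeries_iff {f : Conv 2} :
    f ∈ xSeries ↔ ∀ a : Fin 2 →₀ ℕ, a 1 ≠ 0 → coeff a (f : Formal 2) = 0 := by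
  change pderiv ℂ 1 (f : Formal 2) = 0 ↔ _
  constructor
  · intro h a ha
    have h1 := congrArg (coeff (a - single 1 1)) h
    have hle : single 1 1 ≤ a := single_le_iff.2 (Nat.one_le_iff_ne_zero.2 ha)
    rw [coeff_pderiv, tsub_add_cancel_of_le hle, coeff_zero, mul_eq_zero] at h1
    exact h1.resolve_right (Nat.cast_add_one_ne_zero _)
  · intro h
    ext a
    rw [coeff_pderiv, h _ (by simp), zero_mul, coeff_zero]

/-- The coordinate `x`, as an element of `ℂ{x}`. -/
noncomputable def xSeriesX : xSeries := ⟨convX 0, by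
  change pderiv ℂ 1 (X 0 : Formal 2) = 0
  exact pderiv_X_of_ne (by decide)⟩

theorem isUnit_xSeries {b : xSeries} (hb : constantCoeff (b : Formal 2) ≠ 0) : IsUnit b := by
  obtain ⟨c, hc⟩ := (isUnit_conv_of_constantCoeff_ne_zero hb).exists_right_inv
  have hc' : (b : Formal 2) * c = 1 := congrArg Subtype.val hc
  have hmem : c ∈ xSeries := by
    have h := congrArg (pderiv ℂ 1) hc'
    have hb0 : pderiv ℂ 1 (b : Formal 2) = 0 := b.2
    rw [Derivation.leibniz, hb0, smul_zero, add_zero, smul_eq_mul, pderiv_one] at h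
    exact (mul_eq_zero.1 h).resolve_left fun h0 => by simp [h0] at hb
  exact IsUnit.of_mul_eq_one ⟨c, hmem⟩ (Subtype.ext hc)

theorem exists_associated_xSeriesX_pow {b : xSeries} (hb : b ≠ 0) :
    ∃ n, Associated (xSeriesX ^ n) b := by
  classical
  have hex : ∃ n, coeff (single 0 n) (b : Formal 2) ≠ 0 := by
    by_contra! h
    refine hb (Subtype.ext (Subtype.ext (MvPowerSeries.ext fun a => ?_)))
    change coeff a (b : Formal 2) = 0
    by_cases ha : a 1 = 0
    · convert h (a 0)
      ext i
      fin_cases i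
      · simp
      · simpa using ha
    · exact mem_xSeries_iff.1 b.2 a ha
  set n := Nat.find hex with hn
  have hmin : ∀ k < n, coeff (single 0 k) (b : Formal 2) = 0 := fun k hk => by
    simpa using Nat.find_min hex hk
  have hshift : (⟨shift 0 n b, shift_mem_convergent 0 n (b : Conv 2).2⟩ : Conv 2) ∈ xSeries := by
    rw [mem_xSeries_iff]
    intro a ha
    change coeff a (shift 0 n (b : Formal 2)) = 0
    rw [coeff_shift]
    exact mem_xSeries_iff.1 b.2 _ (by simpa using ha)
  have hunit : IsUnit (⟨_, hshift⟩ : xSeries) := by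
    refine isUnit_xSeries ?_
    change constantCoeff (shift 0 n (b : Formal 2)) ≠ 0
    rw [← coeff_zero_eq_constantCoeff_apply, coeff_shift, zero_add]
    exact Nat.find_spec hex
  refine ⟨n, hunit.unit, Subtype.ext (Subtype.ext (MvPowerSeries.ext fun a => ?_))⟩
  change coeff a (X 0 ^ n * shift 0 n (b : Formal 2)) = coeff a (b : Formal 2)
  rw [coeff_X_pow_mul_shift]
  split_ifs with h
  · rfl
  · symm
    by_cases ha : a 1 = 0
    · convert hmin (a 0) (by omega)
      ext i
      fin_cases i
      · simp
      · simpa using ha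
    · exact mem_xSeries_iff.1 b.2 a ha

theorem irreducible_xSeriesX : Irreducible xSeriesX := by
  constructor
  · intro h
    refine constantCoeff_ne_zero_of_isUnit (h.map xSeries.val) ?_
    change constantCoeff (X 0 : Formal 2) = 0
    simp
  · intro a b hab
    by_contra! h
    have ha : (a : Formal 2) ∈ maxFormal 2 := mem_maxFormal_iff.2 (by
      by_contra h0
      exact h.1 (isUnit_xSeries h0))
    have hb : (b : Formal 2) ∈ maxFormal 2 := mem_maxFormal_iff.2 (by
      by_contra h0
      exact h.2 (isUnit_xSeries h0))
    have hX : (X 0 : Formal 2) = a * b :=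
      congrArg (fun z : xSeries => ((z : Conv 2) : Formal 2)) hab
    have := C_mul_X_add_notMem (a := 1) (b := 0) (by simp)
    rw [map_one, map_zero, one_mul, zero_mul, add_zero, hX, sq] at this
    exact this (Ideal.mul_mem_mul ha hb)

/-- The ring `ℂ{x}` as a type of its own, with a single path to its ring structure: this keeps the
unification problems about polynomials over it small. -/
def XSeries : Type := xSeries

noncomputable instance : CommRing XSeries := inferInstanceAs (CommRing xSeries)

instance : IsDomain XSeries := inferInstanceAs (IsDomain xSeries)

instance : CharZero XSeries :=
  (charZero_of_injective_algebraMap (algebraMap ℂ xSeries).injective : CharZero xSeries)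

instance : IsDiscreteValuationRing XSeries :=
  .ofHasUnitMulPowIrreducibleFactorization
    ⟨xSeriesX, irreducible_xSeriesX, fun hb => exists_associated_xSeriesX_pow hb⟩

/-- The inclusion `ℂ{x} → ℂ{x, y}`. -/
noncomputable def XSeries.toConv : XSeries →+* Conv 2 := xSeries.val.toRingHom

theorem XSeries.pderiv_toConv (r : XSeries) : pderiv ℂ 1 (r.toConv : Formal 2) = 0 :=
  Subtype.property (p := (· ∈ xSeries)) r

/-- The value at `0` of a series in `ℂ{x}`. -/
noncomputable def xSeriesEval : XSeries →+* ℂ :=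
  (constantCoeff.comp (convergent 2).val.toRingHom).comp XSeries.toConv

/-- The inclusion `ℂ{x}[Y] → ℂ{x, y}`, `Y ↦ y`. -/
noncomputable def polyToConv : Polynomial XSeries →+* Conv 2 :=
  Polynomial.eval₂RingHom XSeries.toConv (convX 1)

theorem polyToConv_C (r : XSeries) : polyToConv (Polynomial.C r) = r.toConv := by
  simp [polyToConv]

theorem polyToConv_X : polyToConv Polynomial.X = convX 1 := by
  simp [polyToConv]

theorem constantCoeff_polyToConv (p : Polynomial XSeries) :
    constantCoeff (polyToConv p : Formal 2) = (p.map xSeriesEval).eval 0 := by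
  have : (constantCoeff.comp (convergent 2).val.toRingHom).comp polyToConv =
      (Polynomial.evalRingHom 0).comp (Polynomial.mapRingHom xSeriesEval) := by
    refine Polynomial.ringHom_ext (fun r => ?_) ?_
    · simp [polyToConv_C, xSeriesEval]
    · simp only [RingHom.comp_apply, polyToConv_X]
      change constantCoeff (X 1 : Formal 2) = _
      simp
  exact congrArg (fun φ => φ p) this

theorem pderiv_polyToConv (p : Polynomial XSeries) :
    pderiv ℂ 1 (polyToConv p : Formal 2) = (polyToConv (Polynomial.derivative p) : Formal 2) := by
  have hy : ((convX 1 : Conv 2) : Formal 2) = X 1 := rfl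
  induction p using Polynomial.induction_on' with
  | add p q hp hq => simp [hp, hq]
  | monomial n r =>
    have hr := r.pderiv_toConv
    rw [Polynomial.derivative_monomial, ← Polynomial.C_mul_X_pow_eq_monomial,
      ← Polynomial.C_mul_X_pow_eq_monomial]
    simp only [map_mul, map_pow, polyToConv_C, polyToConv_X, map_natCast, MulMemClass.coe_mul,
      SubmonoidClass.coe_pow, hy, Derivation.leibniz, Derivation.leibniz_pow, hr, pderiv_X_self,
      smul_eq_mul, nsmul_eq_mul, SubringClass.coe_natCast]
    ring

/-- A convergent series of degree less than `d` in `y` is a polynomial in `y` over `ℂ{x}`. -/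
theorem exists_poly_of_shift_eq_zero (d : ℕ) : ∀ g : Conv 2, shift 1 d (g : Formal 2) = 0 →
    ∃ p : Polynomial XSeries, (∀ i, d ≤ i → p.coeff i = 0) ∧ polyToConv p = g ∧
      ∀ i < d, xSeriesEval (p.coeff i) = coeff (single 1 i) (g : Formal 2) := by
  induction d with
  | zero =>
    intro g hg
    refine ⟨0, by simp, ?_, by simp⟩
    rw [map_zero]
    refine Subtype.ext (MvPowerSeries.ext fun a => ?_)
    have := congrArg (coeff a) hg
    rw [coeff_shift, single_zero, add_zero] at this
    exact this.symm
  | succ d ih =>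
    intro g hg
    obtain ⟨p, hp, hpg, hpc⟩ := ih ⟨shift 1 1 g, shift_mem_convergent 1 1 g.2⟩ (by
      ext a
      have := congrArg (coeff a) hg
      rw [coeff_shift] at this
      change coeff a (shift 1 d (shift 1 1 (g : Formal 2))) = _
      rwa [coeff_shift, coeff_shift, add_assoc, ← single_add])
    have hr : (⟨setZero 1 g, setZero_mem_convergent 1 g.2⟩ : Conv 2) ∈ xSeries := by
      rw [mem_xSeries_iff]
      intro a ha
      change coeff a (setZero 1 (g : Formal 2)) = 0
      rw [coeff_setZero, if_neg ha]
    obtain ⟨r, hr⟩ : ∃ r : XSeries, (r.toConv : Formal 2) = setZero 1 g := ⟨⟨_, hr⟩, rfl⟩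
    refine ⟨Polynomial.C r + Polynomial.X * p, ?_, ?_, ?_⟩
    · intro i hi
      obtain ⟨i, rfl⟩ := Nat.exists_eq_add_of_le' (show 1 ≤ i by omega)
      rw [Polynomial.coeff_add, Polynomial.coeff_X_mul, Polynomial.coeff_C_succ,
        hp i (by omega), add_zero]
    · rw [map_add, map_mul, polyToConv_C, polyToConv_X, hpg]
      refine Subtype.ext ?_
      change (r.toConv : Formal 2) + X 1 * shift 1 1 (g : Formal 2) = _
      rw [hr]
      simp [setZero]
    · intro i hi
      rcases Nat.eq_zero_or_pos i with rfl | hi0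
      · rw [Polynomial.coeff_add, Polynomial.coeff_X_mul_zero, Polynomial.coeff_C_zero, add_zero]
        change constantCoeff (r.toConv : Formal 2) = _
        rw [hr, ← coeff_zero_eq_constantCoeff_apply, coeff_setZero]
        simp
      · obtain ⟨i, rfl⟩ := Nat.exists_eq_add_of_le' (show 1 ≤ i by omega)
        rw [Polynomial.coeff_add, Polynomial.coeff_X_mul, Polynomial.coeff_C_succ, zero_add,
          hpc i (by omega)]
        change coeff _ (shift 1 1 (g : Formal 2)) = _
        rw [coeff_shift, ← single_add]

theorem coeff_single_one_mul_of_lt {f : Formal 2} {d : ℕ}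
    (h0 : ∀ a : Fin 2 →₀ ℕ, a 0 = 0 → a 1 < d → coeff a f = 0) (q : Formal 2) {j : ℕ}
    (hj : j < d) : coeff (single 1 j) (f * q) = 0 := by
  classical
  rw [coeff_mul]
  refine Finset.sum_eq_zero fun s hs => ?_
  have hs' := Finset.HasAntidiagonal.mem_antidiagonal.1 hs
  have e0 := DFunLike.congr_fun hs' 0
  have e1 := DFunLike.congr_fun hs' 1
  simp at e0 e1
  rw [h0 s.1 e0.1 (by omega), zero_mul]

theorem coeff_single_one_mul_of_eq {f : Formal 2} {d : ℕ}
    (h0 : ∀ a : Fin 2 →₀ ℕ, a 0 = 0 → a 1 < d → coeff a f = 0) (q : Formal 2) :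
    coeff (single 1 d) (f * q) = coeff (single 1 d) f * constantCoeff q := by
  classical
  rw [coeff_mul, Finset.sum_eq_single (single 1 d, 0)]
  · simp
  · rintro ⟨s, t⟩ hs hne
    have hs' := Finset.HasAntidiagonal.mem_antidiagonal.1 hs
    have e0 := DFunLike.congr_fun hs' 0
    have e1 := DFunLike.congr_fun hs' 1
    simp at e0 e1
    rcases Nat.lt_or_ge (s 1) d with h | h
    · rw [h0 s e0.1 h, zero_mul]
    · refine absurd ?_ hne
      rw [Prod.mk.injEq]
      constructor
      · ext i
        fin_cases i
        · simpa using e0.1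
        · simp
          omega
      · ext i
        fin_cases i
        · simpa using e0.2
        · simp
          omega
  · simp

/-- The Weierstrass preparation theorem in `ℂ{x, y}`. -/
theorem exists_weierstrass_preparation {f : Conv 2} {d : ℕ}
    (h0 : ∀ a : Fin 2 →₀ ℕ, a 0 = 0 → a 1 < d → coeff a (f : Formal 2) = 0)
    (hd : coeff (single 1 d) (f : Formal 2) ≠ 0) :
    ∃ P : Polynomial XSeries, P.Monic ∧ P.map xSeriesEval = Polynomial.X ^ d ∧
      Associated f (polyToConv P) := by
  classical
  obtain ⟨q, hq, hr⟩ := exists_weierstrass_division f.2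
    (pow_mem (X_mem_convergent 1) d : X 1 ^ d ∈ convergent 2) h0 hd
  obtain ⟨p, hp, hpr, hpc⟩ := exists_poly_of_shift_eq_zero d (convX 1 ^ d - f * ⟨q, hq⟩) hr
  have hlt : ∀ j < d, coeff (single 1 j) ((f : Formal 2) * q) = 0 :=
    fun j hj => coeff_single_one_mul_of_lt h0 q hj
  have heq := coeff_single_one_mul_of_eq h0 q
  -- otherwise `y ^ d` would not occur in `f q`
  have hqu : constantCoeff q ≠ 0 := by
    intro h
    have := congrArg (coeff 0) hr
    rw [coeff_shift, zero_add, map_sub, heq, h, mul_zero, coeff_X_pow, if_pos rfl] at this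
    simp at this
  have hunit : IsUnit (⟨q, hq⟩ : Conv 2) := isUnit_conv_of_constantCoeff_ne_zero hqu
  refine ⟨Polynomial.X ^ d - p, Polynomial.monic_X_pow_sub
    ((Polynomial.degree_lt_iff_coeff_zero p d).2 hp), ?_, hunit.unit, ?_⟩
  · have hp0 : p.map xSeriesEval = 0 := by
      ext i
      rw [Polynomial.coeff_map, Polynomial.coeff_zero]
      rcases Nat.lt_or_ge i d with h | h
      · rw [hpc i h]
        have h1 : coeff (single 1 i) (X 1 ^ d - (f : Formal 2) * q) = 0 := by
          rw [map_sub, hlt i h, coeff_X_pow, if_neg, sub_zero]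
          exact fun h' => h.ne (single_injective _ h')
        exact h1
      · rw [hp i h, map_zero]
    rw [Polynomial.map_sub, hp0, sub_zero, Polynomial.map_pow, Polynomial.map_X]
  · rw [map_sub, map_pow, polyToConv_X, hpr, IsUnit.unit_spec]
    ring

/-! ### Convergent series without multiple factors have no multiple formal factors -/

/-- By Gauss' lemma, a monic polynomial without multiple monic factors over an integrally closed
domain of characteristic zero is separable over the fraction field; hence the ideal it generates
together with its derivative contains a nonzero constant. -/
theorem exists_combination_eq_C {A : Type*} [CommRing A] [IsDomain A] [IsIntegrallyClosed A]
    [CharZero A] {P : Polynomial A} (hP : P.Monic)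
    (hsq : ∀ g : Polynomial A, g.Monic → g * g ∣ P → g = 1) :
    ∃ U V : Polynomial A, ∃ c : A, c ≠ 0 ∧
      U * P + V * Polynomial.derivative P = Polynomial.C c := by
  set K := FractionRing A
  have hinj : Function.Injective (algebraMap A K) := FaithfulSMul.algebraMap_injective _ _
  have : CharZero K := charZero_of_injective_algebraMap hinj
  have hsqK : Squarefree (P.map (algebraMap A K)) := by
    intro g hg
    have hP0 : P.map (algebraMap A K) ≠ 0 := (hP.map _).ne_zero
    have hg0 : g ≠ 0 := by
      rintro rfl
      exact hP0 (by simpa using hg)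
    obtain ⟨g', hg'⟩ := IsIntegrallyClosed.eq_map_mul_C_of_dvd K hP
      ((dvd_mul_right g g).trans hg)
    have hg'm : g'.Monic := by
      have h := congrArg Polynomial.leadingCoeff hg'
      rw [Polynomial.leadingCoeff_mul, Polynomial.leadingCoeff_C,
        Polynomial.leadingCoeff_map_of_injective hinj] at h
      have h1 := mul_right_cancel₀ (Polynomial.leadingCoeff_ne_zero.2 hg0)
        (h.trans (one_mul _).symm)
      exact hinj (h1.trans (map_one _).symm)
    have hdvd : g' * g' ∣ P := by
      rw [← Polynomial.map_dvd_map _ hinj (hg'm.mul hg'm), Polynomial.map_mul]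
      have hgg : g'.map (algebraMap A K) ∣ g := ⟨_, hg'.symm⟩
      exact (mul_dvd_mul hgg hgg).trans hg
    rw [hsq g' hg'm hdvd, Polynomial.map_one, one_mul] at hg'
    rw [← hg']
    exact (IsUnit.mk0 _ (Polynomial.leadingCoeff_ne_zero.2 hg0)).map Polynomial.C
  obtain ⟨a, b, hab⟩ := PerfectField.separable_iff_squarefree.2 hsqK
  obtain ⟨s, hs, ha⟩ := IsLocalization.integerNormalization_spec (nonZeroDivisors A) a
  obtain ⟨t, ht, hb⟩ := IsLocalization.integerNormalization_spec (nonZeroDivisors A) b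
  set a' := IsLocalization.integerNormalization (nonZeroDivisors A) a
  set b' := IsLocalization.integerNormalization (nonZeroDivisors A) b
  refine ⟨Polynomial.C t * a', Polynomial.C s * b', s * t, nonZeroDivisors.ne_zero
    (mul_mem hs ht), Polynomial.map_injective _ hinj ?_⟩
  rw [Algebra.smul_def, Polynomial.algebraMap_apply] at ha hb
  rw [Polynomial.derivative_map] at hab
  simp only [Polynomial.map_add, Polynomial.map_mul, Polynomial.map_C, ha, hb, map_mul]
  linear_combination Polynomial.C (algebraMap A K s) * Polynomial.C (algebraMap A K t) * hab

/-- A Weierstrass polynomial that is squarefree in `ℂ{x, y}` has no multiple monic factors: a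
monic factor of positive degree reduces to a power of `Y`, so it vanishes at the origin. -/
theorem eq_one_of_sq_dvd {P : Polynomial XSeries} {d : ℕ}
    (hPd : P.map xSeriesEval = Polynomial.X ^ d) (hsq : Squarefree (polyToConv P))
    (g : Polynomial XSeries) (hg : g.Monic) (hdvd : g * g ∣ P) : g = 1 := by
  have hu : IsUnit (polyToConv g) := hsq _ (by
    rw [← map_mul]
    exact map_dvd polyToConv hdvd)
  have hred : g.map xSeriesEval ∣ Polynomial.X ^ d := by
    rw [← hPd]
    exact Polynomial.map_dvd _ ((dvd_mul_right g g).trans hdvd)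
  obtain ⟨i, -, hi⟩ := (dvd_prime_pow Polynomial.prime_X d).1 hred
  have hi' : g.map xSeriesEval = Polynomial.X ^ i :=
    Polynomial.eq_of_monic_of_associated (hg.map _) (Polynomial.monic_X_pow i) hi
  have hc := constantCoeff_ne_zero_of_isUnit hu
  rw [constantCoeff_polyToConv, hi', Polynomial.eval_pow, Polynomial.eval_X] at hc
  have hi0 : i = 0 := by
    by_contra h
    exact hc (zero_pow h)
  refine hg.natDegree_eq_zero.1 ?_
  rw [← hg.natDegree_map xSeriesEval, hi', hi0]
  simp

/-- The weighted order for the weights `(1, 0)` is the `x`-adic valuation, and it is additive. -/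
theorem prime_X_zero : Prime (X 0 : Formal 2) := by
  have key : ∀ g : Formal 2, X 0 ∣ g ↔ g.weightedOrder (![1, 0] : Fin 2 → ℕ) ≠ 0 := by
    intro g
    have hw : ∀ a : Fin 2 →₀ ℕ, Finsupp.weight (![1, 0] : Fin 2 → ℕ) a = a 0 := fun a => by
      rw [Finsupp.weight_apply, Finsupp.sum_fintype _ _ (by simp)]
      simp
    rw [X_dvd_iff]
    constructor
    · intro h
      have : ((1 : ℕ) : ℕ∞) ≤ g.weightedOrder (![1, 0] : Fin 2 → ℕ) :=
        nat_le_weightedOrder _ fun a ha => h a (by rw [hw] at ha; omega)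
      intro h0
      rw [h0] at this
      simp at this
    · intro h a ha
      refine coeff_eq_zero_of_lt_weightedOrder (![1, 0] : Fin 2 → ℕ) ?_
      rw [hw, ha]
      exact pos_iff_ne_zero.2 h
  refine ⟨fun h => ?_, fun h => ?_, fun a b hab => ?_⟩
  · have := congrArg (coeff (single 0 1)) h
    rw [coeff_index_single_self_X] at this
    simp at this
  · exact not_isUnit_of_mem_maxFormal (X_mem_maxFormal 0) h
  · rw [key, weightedOrder_mul] at hab
    rw [key, key]
    by_contra! h
    simp [h.1, h.2] at hab

/-- The case where `f` is not divisible by `x`, that is, `f(0, y)` has a finite order `d`. -/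
theorem isUnit_of_sq_dvd_of_regular {f : Conv 2} (hf : Squarefree f) {d : ℕ}
    (h0 : ∀ a : Fin 2 →₀ ℕ, a 0 = 0 → a 1 < d → coeff a (f : Formal 2) = 0)
    (hd : coeff (single 1 d) (f : Formal 2) ≠ 0) {h : Formal 2} (hh : h * h ∣ (f : Formal 2)) :
    IsUnit h := by
  obtain ⟨P, hP, hPd, hfP⟩ := exists_weierstrass_preparation h0 hd
  obtain ⟨U, V, c, hc, hUV⟩ := exists_combination_eq_C hP
    (eq_one_of_sq_dvd hPd (hf.squarefree_of_dvd hfP.symm.dvd))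
  have hhP : h * h ∣ (polyToConv P : Formal 2) :=
    hh.trans (map_dvd (convergent 2).val hfP.dvd)
  -- a double factor of `P` divides `P` and its derivative, hence the constant `c`
  have hh1 : h ∣ (polyToConv P : Formal 2) := (dvd_mul_right h h).trans hhP
  have hh2 : h ∣ (polyToConv (Polynomial.derivative P) : Formal 2) := by
    rw [← pderiv_polyToConv]
    obtain ⟨g, hg⟩ := hhP
    rw [hg]
    simp only [Derivation.leibniz, smul_eq_mul]
    exact ⟨h * pderiv ℂ 1 g + 2 * g * pderiv ℂ 1 h, by ring⟩
  have hhc : h ∣ (c.toConv : Formal 2) := by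
    have := congrArg (fun p => (polyToConv p : Formal 2)) hUV
    simp only [map_add, map_mul, polyToConv_C] at this
    rw [← this]
    exact dvd_add (Dvd.dvd.mul_left hh1 _) (Dvd.dvd.mul_left hh2 _)
  obtain ⟨n, hn⟩ := exists_associated_xSeriesX_pow hc
  have hcn : (c.toConv : Formal 2) ∣ X 0 ^ n :=
    map_dvd ((convergent 2).val.toRingHom.comp xSeries.val.toRingHom) hn.symm.dvd
  obtain ⟨i, -, hi⟩ := (dvd_prime_pow prime_X_zero n).1 (hhc.trans hcn)
  rcases Nat.eq_zero_or_pos i with rfl | hi0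
  · rw [pow_zero] at hi
    exact associated_one_iff_isUnit.1 hi
  · have hX : X 0 ∣ (f : Formal 2) :=
      (dvd_pow_self (X 0 : Formal 2) hi0.ne').trans (hi.symm.dvd.trans
        ((dvd_mul_right h h).trans hh))
    exact absurd (X_dvd_iff.1 hX _ (by simp)) hd

/-- A squarefree convergent power series in two variables has no multiple formal factors. -/
theorem isUnit_of_sq_dvd {f : Conv 2} (hf : Squarefree f) {h : Formal 2}
    (hh : h * h ∣ (f : Formal 2)) : IsUnit h := by
  classical
  have hex : ∃ k, ∃ a : Fin 2 →₀ ℕ, a 0 = k ∧ coeff a (f : Formal 2) ≠ 0 := by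
    by_contra! h0
    exact hf.ne_zero (Subtype.ext (MvPowerSeries.ext fun a => h0 _ a rfl))
  -- split off the power of `x` that divides `f`
  set k := Nat.find hex with hk
  have hmin : ∀ a : Fin 2 →₀ ℕ, a 0 < k → coeff a (f : Formal 2) = 0 := fun a ha => by
    by_contra h0
    exact Nat.find_min hex ha ⟨a, rfl, h0⟩
  set g : Conv 2 := ⟨shift 0 k f, shift_mem_convergent 0 k f.2⟩ with hg
  have hfg : (f : Formal 2) = (X 0 : Formal 2) ^ k * (g : Formal 2) := by
    ext a
    rw [hg, coeff_X_pow_mul_shift]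
    split_ifs with h0
    · rfl
    · exact hmin a (by omega)
  have hfg' : f = convX 0 ^ k * g := Subtype.ext hfg
  have hgsq : Squarefree g := hf.squarefree_of_dvd ⟨_, hfg'.trans (mul_comm _ _)⟩
  have hex' : ∃ d, coeff (single 1 d) (g : Formal 2) ≠ 0 := by
    obtain ⟨a, ha, hne⟩ := Nat.find_spec hex
    refine ⟨a 1, ?_⟩
    rw [hg, coeff_shift]
    convert hne
    ext i
    fin_cases i
    · simpa using ha.symm
    · simp
  set d := Nat.find hex' with hd
  have hreg0 : ∀ a : Fin 2 →₀ ℕ, a 0 = 0 → a 1 < d → coeff a (g : Formal 2) = 0 := by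
    intro a ha hlt
    have := Nat.find_min hex' hlt
    rw [not_not] at this
    convert this
    ext i
    fin_cases i
    · simpa using ha
    · simp
  have hregd := Nat.find_spec hex'
  have hXg : ¬ X 0 ∣ (g : Formal 2) := fun hX => hregd (X_dvd_iff.1 hX _ (by simp))
  have hk1 : k ≤ 1 := by
    by_contra hk2
    obtain ⟨l, hl⟩ := Nat.exists_eq_add_of_le' (show 2 ≤ k by omega)
    have hu := hf (convX 0) ⟨convX 0 ^ l * g, by rw [hfg', hl]; ring⟩
    refine constantCoeff_ne_zero_of_isUnit hu ?_
    change constantCoeff (X 0 : Formal 2) = 0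
    simp
  have hXh : ¬ X 0 ∣ h := by
    rintro ⟨b, rfl⟩
    have h1 : X 0 * X 0 ∣ X 0 * (g : Formal 2) := by
      refine Dvd.dvd.trans ⟨b * b, by ring⟩ (hh.trans ?_)
      rw [hfg]
      refine mul_dvd_mul_right ?_ _
      simpa using pow_dvd_pow (X 0 : Formal 2) hk1
    exact hXg ((mul_dvd_mul_iff_left prime_X_zero.ne_zero).1 h1)
  have hXhh : ¬ X 0 ∣ h * h := fun hX => (prime_X_zero.dvd_or_dvd hX).elim hXh hXh
  obtain ⟨b, hb⟩ := hh
  have hkb : X 0 ^ k ∣ b :=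
    prime_X_zero.pow_dvd_of_dvd_mul_left k hXhh ⟨g, by rw [← hb, hfg]⟩
  obtain ⟨b', rfl⟩ := hkb
  refine isUnit_of_sq_dvd_of_regular hgsq hreg0 hregd ⟨b', ?_⟩
  refine mul_left_cancel₀ (pow_ne_zero k prime_X_zero.ne_zero) ?_
  rw [← hfg, hb]
  ring

/-! ### Extension of derivations to the formal power series ring -/

theorem mem_maxFormal_of_mem_maxConv {k : ℕ} {g : Conv 2} (hg : g ∈ maxConv 2 ^ k) :
    (g : Formal 2) ∈ maxFormal 2 ^ k := by
  have h : (maxConv 2).map (convergent 2).val ≤ maxFormal 2 := by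
    rw [maxConv, Ideal.map_span, Ideal.span_le]
    rintro _ ⟨_, ⟨i, rfl⟩, rfl⟩
    exact X_mem_maxFormal i
  have h1 := Ideal.mem_map_of_mem (convergent 2).val hg
  rw [Ideal.map_pow] at h1
  exact Ideal.pow_right_mono h k h1

/-- Every derivation of `ℂ{x, y}` extends to `ℂ[[x, y]]`, as `δ(x) ∂/∂x + δ(y) ∂/∂y`: two
derivations that agree on the coordinates differ by a derivation with values in every power of the
maximal ideal. -/
theorem eq_pderiv_combination (δ : Derivation ℂ (Conv 2) (Conv 2)) (g : Conv 2) :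
    ((δ g : Conv 2) : Formal 2) = (δ (convX 0) : Formal 2) * pderiv ℂ 0 (g : Formal 2) +
      (δ (convX 1) : Formal 2) * pderiv ℂ 1 (g : Formal 2) := by
  rw [← sub_eq_zero]
  refine eq_zero_of_forall_mem_pow fun k => ?_
  induction k generalizing g with
  | zero => simp
  | succ k ih =>
    set g₀ : Conv 2 := ⟨shift 0 1 g, shift_mem_convergent 0 1 g.2⟩
    set g₁ : Conv 2 := ⟨shift 1 1 (setZero 0 g),
      shift_mem_convergent 1 1 (setZero_mem_convergent 0 g.2)⟩
    have hg : g = algebraMap ℂ _ (constantCoeff (g : Formal 2)) + convX 0 * g₀ + convX 1 * g₁ :=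
      Subtype.ext (eq_C_add_X_mul (g : Formal 2))
    have hg' : (g : Formal 2) = C (constantCoeff (g : Formal 2)) + X 0 * (g₀ : Formal 2) +
      X 1 * (g₁ : Formal 2) := eq_C_add_X_mul (g : Formal 2)
    have hδ : ((δ g : Conv 2) : Formal 2) = X 0 * (δ g₀ : Formal 2) +
        (g₀ : Formal 2) * (δ (convX 0) : Formal 2) +
        (X 1 * (δ g₁ : Formal 2) + (g₁ : Formal 2) * (δ (convX 1) : Formal 2)) := by
      conv_lhs => rw [hg]
      simp only [map_add, Derivation.map_algebraMap, zero_add, Derivation.leibniz, smul_eq_mul]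
      rfl
    have h0 := Ideal.mul_mem_mul (X_mem_maxFormal 0) (ih g₀)
    have h1 := Ideal.mul_mem_mul (X_mem_maxFormal 1) (ih g₁)
    rw [← pow_succ'] at h0 h1
    convert add_mem h0 h1 using 1
    rw [hδ]
    have hp0 : pderiv ℂ 0 (g : Formal 2) = X 0 * pderiv ℂ 0 (g₀ : Formal 2) + (g₀ : Formal 2) +
        X 1 * pderiv ℂ 0 (g₁ : Formal 2) := by
      conv_lhs => rw [hg']
      simp [pderiv_X_of_ne (R := ℂ) (show (1 : Fin 2) ≠ 0 by decide)]
    have hp1 : pderiv ℂ 1 (g : Formal 2) = X 0 * pderiv ℂ 1 (g₀ : Formal 2) +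
        (X 1 * pderiv ℂ 1 (g₁ : Formal 2) + (g₁ : Formal 2)) := by
      conv_lhs => rw [hg']
      simp [pderiv_X_of_ne (R := ℂ) (show (0 : Fin 2) ≠ 1 by decide)]
    rw [hp0, hp1]
    ring

/-- The statement for formal derivations: a double formal factor of `f`, which a derivation that is
not topologically nilpotent would produce, is excluded by `isUnit_of_sq_dvd`. -/
theorem isTopNilpotent_of_formal_logarithmic {f : Conv 2} (hred : Squarefree f)
    (hf : f ∈ maxConv 2 ^ 3) {δ : Derivation ℂ (Formal 2) (Formal 2)}
    (hδ : ∀ g, δ g ∈ maxFormal 2)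
    (hδf : δ (f : Formal 2) ∈ maxFormal 2 * Ideal.span {(f : Formal 2)}) :
    IsTopNilpotent δ := by
  by_contra hnil
  obtain ⟨a, ha, haf⟩ := Ideal.mem_mul_span_singleton.1 hδf
  obtain ⟨h, hh, hdvd⟩ := exists_sq_dvd_of_not_isTopNilpotent hδ ha haf.symm
    (fun h0 => hred.ne_zero (Subtype.ext h0)) (mem_maxFormal_of_mem_maxConv hf) hnil
  exact not_isUnit_of_mem_maxFormal hh (isUnit_of_sq_dvd hred hdvd)

end PlaneCurve

theorem mainTheorem7 (f : PlaneCurve.Conv 2) (hred : Squarefree f)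
    (hprod : ¬ PlaneCurve.IsProduct f) (hf : f ∈ PlaneCurve.maxConv 2 ^ 3) :
    (∀ δ : Derivation ℂ (PlaneCurve.Conv 2) (PlaneCurve.Conv 2),
      δ ∈ PlaneCurve.singularDer (PlaneCurve.maxConv 2) →
      δ ∈ PlaneCurve.logDer f →
      δ f ∈ PlaneCurve.maxConv 2 * Ideal.span {f} →
      PlaneCurve.IsTopNilpotentConv δ) ∧
    (∀ δ : Derivation ℂ (PlaneCurve.Formal 2) (PlaneCurve.Formal 2),
      δ ∈ PlaneCurve.singularDer (PlaneCurve.maxFormal 2) →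
      δ ∈ PlaneCurve.logDer (f : PlaneCurve.Formal 2) →
      δ (f : PlaneCurve.Formal 2) ∈
        PlaneCurve.maxFormal 2 * Ideal.span {(f : PlaneCurve.Formal 2)} →
      PlaneCurve.IsTopNilpotent δ) := by
  refine ⟨fun δ hδ _ hδf => ?_, fun δ hδ _ hδf =>
    PlaneCurve.isTopNilpotent_of_formal_logarithmic hred hf
      (PlaneCurve.apply_mem_of_mem_singularDer hδ) hδf⟩
  let δ' : Derivation ℂ (PlaneCurve.Formal 2) (PlaneCurve.Formal 2) :=
    (δ (PlaneCurve.convX 0) : PlaneCurve.Formal 2) • MvPowerSeries.pderiv ℂ 0 +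
      (δ (PlaneCurve.convX 1) : PlaneCurve.Formal 2) • MvPowerSeries.pderiv ℂ 1
  have hext : ∀ g : PlaneCurve.Conv 2, δ' (g : PlaneCurve.Formal 2) =
      ((δ g : PlaneCurve.Conv 2) : PlaneCurve.Formal 2) :=
    fun g => (PlaneCurve.eq_pderiv_combination δ g).symm
  have hmem : ∀ g : PlaneCurve.Conv 2,
      ((δ g : PlaneCurve.Conv 2) : PlaneCurve.Formal 2) ∈ PlaneCurve.maxFormal 2 := fun g => by
    have := PlaneCurve.apply_mem_of_mem_singularDer hδ g
    rw [← pow_one (PlaneCurve.maxConv 2)] at this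
    simpa using PlaneCurve.mem_maxFormal_of_mem_maxConv this
  refine ⟨δ', hext, PlaneCurve.isTopNilpotent_of_formal_logarithmic hred hf (fun g => ?_) ?_⟩
  · exact add_mem (Ideal.mul_mem_right _ _ (hmem _)) (Ideal.mul_mem_right _ _ (hmem _))
  · obtain ⟨a, ha, haf⟩ := Ideal.mem_mul_span_singleton.1 hδf
    rw [hext, ← haf, Ideal.mem_mul_span_singleton]
    rw [← pow_one (PlaneCurve.maxConv 2)] at ha
    exact ⟨a, by simpa using PlaneCurve.mem_maxFormal_of_mem_maxConv ha, rfl⟩
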